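/- **Setting.** An input of size $n$ of online matching on the line consists of servers $s_1\le\dots\le s_n$ in $\mathbb R$, known in advance, and requests $r_1,\dots,r_n\in\mathbb R$, which arrive one by one; each request is matched on arrival to an unmatched server, at a cost equal to their distance. $\mathrm{OPT}$ is the least total cost of a perfect matching. A (possibly randomized) online algorithm $\mathrm A$ is $c(n)$-competitive with additive constant $\alpha$ if on every input of every size $n$ its (expected) cost is at most $c(n)\cdot\mathrm{OPT}+\alpha$. An online algorithm with advice may in addition read bits, one after the other, from an infinite tape written by an oracle that knows the whole input. **Algorithm $\mathrm{LR}$** serves a request $r$ as follows: match $r$ to an unmatched server at $r$ if there is one; otherwise, if all unmatched servers are greater (less) than $r$, to the least (greatest) of them; otherwise read a bit, and match $r$ to the greatest unmatched server less than $r$ if it is $0$, and to the least unmatched server greater than $r$ if it is $1$. **Algorithm $\mathrm{DIVIDE}_k$** ($1\le k\le n$, with subroutine $\mathrm A$), for inputs with $s_1=1$, $s_n=N-1$, $N\in\mathbb Z^+$, and $r_i\in\mathbb Z$ for all $i$. Split the servers, in increasing order, into consecutive blocks $S_1,\dots,S_k$, the first $n \bmod k$ of size $\lceil n/k\rceil$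 and the others of size $\lfloor n/k\rfloor$. Let $p_i=\frac12(\max S_i+\min S_{i+1})$ for $1\le i<k$, $p_0=-\infty$, $p_k=\infty$, and $B_i=(p_{i-1},p_i]$ (with $B_k=(p_{k-1},\infty)$). Below, let $\pi$ be an optimal matching with $\pi(i)<\pi(j)$ whenever $r_i<r_j$; the pair of $r_i$ is $s_{\pi(i)}$, and the position of a request $r$ means $\max(0,\min(N,r))$. *Advice.* Positions are written with $\lfloor\log_2N\rfloor+1$ bits and numbers of requests with $\lfloor\log_2 n\rfloor+1$ bits. The algorithm reads, for $i=2,\dots,k$, the position $q_{i,L}$ of the rightmost request in $B_i$ whose pair is in some $S_j$, $j<i$ ($0$ if there is none); for $i=1,\dots,k-1$, the position $q_{i,R}$ of the leftmost request in $B_i$ whose pair is in some $S_j$, $j>i$ (the all-ones word if there is none); for $i=1,\dots,k-1$, unless $q_{i,R}$ is the all-ones word, the number $d_{i,R}$ of requests in $B_i$ at position $q_{i,R}$ with pairs in $S_i$ and the number $m_{i,R}$ of requests in $B_i$ with pairs in $\bigcup_{j>i}S_j$; for $i=k,\dots,2$, if $q_{i,L}>0$, the number $d_{i,L}$ of requests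 in $B_i$ at position $q_{i,L}$ with pairs in $\bigcup_{j\ge i}S_j$ and the number $m_{i,L}$ of requests in $B_i$ with pairs in $\bigcup_{j<i}S_j$. (Numbers not read are $0$.) *Marking servers.* For $i=1,\dots,k-1$ mark the $m_{i,R}$ consecutive servers that begin with the first server of $\bigcup_{j>i}S_j$ not yet marked in this procedure. Independently, for $i=k,\dots,2$ mark the $m_{i,L}$ consecutive servers that end with the last server of $\bigcup_{j<i}S_j$ not yet marked in this second procedure. *Serving a request* $r\in B_j$ at position $y$. If $j>1$ and either $y<q_{j,L}$, or $y=q_{j,L}$ and at least $d_{j,L}$ earlier requests at position $y$ were not marked left, mark $r$ left. Otherwise, if $j<k$ and either $y>q_{j,R}$, or $y=q_{j,R}$ and at least $d_{j,R}$ earlier requests at position $y$ were left unmarked, mark $r$ right. Otherwise leave $r$ unmarked. An unmarked request in $B_j$ is served by $\mathrm A$, run on the unmarked servers of $S_j$ and the unmarked requests in $B_j$. A marked request is served by $\mathrm{LR}$, run on the marked servers and the marked requests, where $\mathrm{LR}$, if it reads a bit for this request, gets $0$ for a request marked left and $1$ for one marked right. **Theorem.** There is an absolute constant $C$ such that the following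 holds for every integer $k\ge1$. Let $\mathrm A$ be a (deterministic or randomized) online matching algorithm on the line that is $c(n)$-competitive with additive constant $\alpha$, where $c(n)$ is nondecreasing in $n\ge1$. Then, on every input of size $n\ge k$ with $s_1=1$, $s_n=N-1$, $N\in\mathbb Z^+$, and all $r_i\in\mathbb Z$: 1. $\mathrm{DIVIDE}_k$ reads at most $C\,k\,(\log_2N+\log_2n)$ bits, whatever is written on the advice tape; 2. there is an advice tape, depending on the input but not on the random choices of $\mathrm A$, for which $\mathrm{DIVIDE}_k$ outputs a perfect matching whose (expected) cost is at most $c(\lceil n/k\rceil)\cdot\mathrm{OPT}+k\alpha$. That is, $\mathrm{DIVIDE}_k$ is $c(\lceil n/k\rceil)$-competitive and reads $O(k(\log N+\log n))$ bits of advice. -/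

import Mathlib

/-! Online minimum matching on the line.  An input of size `n` is a nondecreasing list `s` of `n`
server positions and a list `r` of `n` request positions, in order of arrival.  Servers are referred
to by their index in the list `s` (counted from `0`). -/

noncomputable section

namespace LineMatching

/-- `(s, r)` is an input: the servers are sorted and there are as many requests as servers. -/
def IsInput (s r : List ℝ) : Prop :=
  s.Pairwise (· ≤ ·) ∧ r.length = s.length

/-- A list of server indices (the server of the first request, of the second one, ...) is a perfect
matching if it is a permutation of all `n` server indices. -/
def IsMatching (n : ℕ) (σ : List ℕ) : Prop :=
  σ.Perm (List.range n)

/-- Total distance between the requests `r` and the servers `σ` assigned to them. -/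
def cost (s r : List ℝ) (σ : List ℕ) : ℝ :=
  (List.zipWith (fun x j => |x - s.getD j 0|) r σ).sum

/-- The optimal (offline) cost: the least cost of a perfect matching. -/
def opt (s r : List ℝ) : ℝ :=
  sInf {x | ∃ σ, IsMatching s.length σ ∧ x = cost s r σ}

/-- The outcome of serving the requests `r` one by one, where `serve s past x` is the index of the
server assigned to the current request `x` after the requests `past` (in order of arrival). -/
def runServe (serve : List ℝ → List ℝ → ℝ → ℕ) (s r : List ℝ) : List ℕ :=
  r.mapIdx (fun i x => serve s (r.take i) x)

/-- A deterministic online matching algorithm (without advice): every request is assigned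
irrevocably on the basis of the servers, the earlier requests and the request itself, and no server
is used twice. -/
structure OnlineAlg where
  serve : List ℝ → List ℝ → ℝ → ℕ
  legal : ∀ s r, IsInput s r → IsMatching s.length (runServe serve s r)

/-- The matching produced by an online algorithm. -/
def OnlineAlg.run (A : OnlineAlg) (s r : List ℝ) : List ℕ :=
  runServe A.serve s r

open MeasureTheory in
/-- A randomized online algorithm is a family of deterministic ones indexed by the points of a
probability space, every decision being a random variable.  (A deterministic algorithm is the case
of a one-point space.) -/
def IsRandomized {Ω : Type*} [MeasurableSpace Ω] (A : Ω → OnlineAlg) : Prop :=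
  ∀ (s past : List ℝ) (x : ℝ), past.length < s.length →
    Measurable (fun ω => (A ω).serve s past x)

open MeasureTheory in
/-- `A` is `c(n)`-competitive with additive constant `α`: its (expected) cost on every input of size
`n` is at most `c n` times the optimal cost plus `α`. -/
def IsCompetitive {Ω : Type*} [MeasurableSpace Ω] (μ : Measure Ω) (A : Ω → OnlineAlg)
    (c : ℕ → ℝ) (α : ℝ) : Prop :=
  ∀ s r, IsInput s r → ∫ ω, cost s r ((A ω).run s r) ∂μ ≤ c s.length * opt s r + α

/-! ### The tape model of advice -/

/-- A computation that may read bits from the advice tape, one after the other. -/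
inductive BitReader (β : Type) : Type
  | done (b : β) : BitReader β
  | read (next : Bool → BitReader β) : BitReader β

namespace BitReader

def bind {β γ : Type} : BitReader β → (β → BitReader γ) → BitReader γ
  | done b, f => f b
  | read next, f => read (fun b => (next b).bind f)

instance : Monad BitReader where
  pure := done
  bind := bind

/-- The result of the computation on an infinite tape. -/
def eval {β : Type} : BitReader β → (ℕ → Bool) → β
  | done b, _ => b
  | read next, t => (next (t 0)).eval (fun i => t (i + 1))

/-- The number of bits that the computation reads from the tape. -/
def bits {β : Type} : BitReader β → (ℕ → Bool) → ℕ
  | done _, _ => 0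
  | read next, t => (next (t 0)).bits (fun i => t (i + 1)) + 1

/-- Read one bit. -/
def bit : BitReader Bool := read done

/-- Read a word of `w` bits, as a binary number (most significant bit first). -/
def word : ℕ → BitReader ℕ
  | 0 => pure 0
  | w + 1 => do
    let b ← bit
    let x ← word w
    pure (b.toNat * 2 ^ w + x)

/-- Perform `f i` for each `i` of the list, in this order, and return the table of results. -/
def table {β : Type} (dflt : β) (f : ℕ → BitReader β) : List ℕ → BitReader (ℕ → β)
  | [] => pure (fun _ => dflt)
  | i :: l => do
    let x ← f i
    let g ← table dflt f l
    pure (Function.update g i x)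

end BitReader

/-- An online matching algorithm with advice: it sees the servers, then the requests one by one;
it assigns each request before it sees the next one, and may read bits of the advice tape at any
time. -/
structure AdviceAlg where
  State : Type
  init : List ℝ → BitReader State
  step : State → ℝ → BitReader (State × ℕ)

/-- Serve the requests of a list from a given state. -/
def AdviceAlg.serveFrom (D : AdviceAlg) : D.State → List ℝ → BitReader (List ℕ)
  | _, [] => pure []
  | st, x :: l => do
    let (st', j) ← D.step st x
    let σ ← D.serveFrom st' l
    pure (j :: σ)

/-- The whole computation on servers `s` and requests `r`; the result is the list of the servers
assigned to the requests. -/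
def AdviceAlg.run (D : AdviceAlg) (s r : List ℝ) : BitReader (List ℕ) := do
  let st ← D.init s
  D.serveFrom st r

/-! ### Algorithm LR -/

/-- Least element (junk value `0` for the empty set). -/
def least (F : Finset ℕ) : ℕ := F.min.untopD 0

/-- Greatest element (junk value `0` for the empty set). -/
def greatest (F : Finset ℕ) : ℕ := F.max.unbotD 0

/-- How algorithm LR serves a request at `x` when `free` is the set of the unmatched servers.  As
the servers are sorted, the least server is the one of least index. -/
def lrServe (s : List ℝ) (free : Finset ℕ) (x : ℝ) : BitReader ℕ :=
  let equal := free.filter (fun j => s.getD j 0 = x)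
  let smaller := free.filter (fun j => s.getD j 0 < x)
  let greater := free.filter (fun j => x < s.getD j 0)
  if equal.Nonempty then pure (least equal)
  else if smaller = ∅ then pure (least greater)
  else if greater = ∅ then pure (greatest smaller)
  else do
    let b ← BitReader.bit
    pure (if b then least greater else greatest smaller)

/-! ### Algorithm DIVIDE

Blocks are numbered `1, ..., k`.  In the comments, `π` is an optimal matching with
`π(i) < π(j)` whenever `r_i < r_j`, the pair of `r_i` is its partner under `π`, and positions of
requests are truncated to the interval `[0, N]`. -/

/-- The number of servers in the first `i` blocks, when `n` servers are divided into `k` blocks of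
which the first `n % k` have size `⌈n/k⌉` and the others have size `⌊n/k⌋`. -/
def blockEnd (n k i : ℕ) : ℕ := i * (n / k) + min i (n % k)

/-- The border `p_i` between block `i` and block `i + 1`: the midpoint of the last server of block
`i` and the first server of block `i + 1`. -/
def border (s : List ℝ) (k i : ℕ) : ℝ :=
  (s.getD (blockEnd s.length k i - 1) 0 + s.getD (blockEnd s.length k i) 0) / 2

/-- The number `j` of the block `B_j` that contains `x`, where `B_1 = (-∞, p_1]`,
`B_j = (p_{j-1}, p_j]` for `1 < j < k` and `B_k = (p_{k-1}, ∞)`. -/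
def blockOf (s : List ℝ) (k : ℕ) (x : ℝ) : ℕ :=
  ((List.range' 1 (k - 1)).find? (fun i => decide (x ≤ border s k i))).getD k

/-- The number `N` with `s_n = N - 1`. -/
def span (s : List ℝ) : ℕ := ⌊s.getLastD 0⌋₊ + 1

/-- Truncation of a position to `[0, N]`. -/
def trunc (s : List ℝ) (x : ℝ) : ℝ := max 0 (min (span s : ℝ) x)

/-- The data that DIVIDE reads from the advice tape.

* `qL i` is the position of the rightmost request of `B_i` whose pair lies in an earlier block, and
  `0` if there is none;
* `qR i` is the position of the leftmost request of `B_i` whose pair lies in a later block, and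
  the all-ones word if there is none;
* `dR i` is the number of requests in `B_i` at position `qR i` whose pairs are in `S_i`;
* `mR i` is the number of requests in `B_i` whose pairs lie in later blocks;
* `dL i` is the number of requests in `B_i` at position `qL i` whose pairs are not in an earlier
  block;
* `mL i` is the number of requests in `B_i` whose pairs lie in earlier blocks. -/
structure DivideAdvice where
  qL : ℕ → ℕ
  qR : ℕ → ℕ
  dR : ℕ → ℕ
  mR : ℕ → ℕ
  dL : ℕ → ℕ
  mL : ℕ → ℕ

/-- Reading the advice.  Positions are words of `⌊log₂ N⌋ + 1` bits, numbers of requests are words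
of `⌊log₂ n⌋ + 1` bits; the latter are read only for the blocks where there is such a request. -/
def readAdvice (s : List ℝ) (k : ℕ) : BitReader DivideAdvice := do
  let wN := Nat.log 2 (span s) + 1
  let wn := Nat.log 2 s.length + 1
  let pair : BitReader (ℕ × ℕ) := do
    let d ← BitReader.word wn
    let m ← BitReader.word wn
    pure (d, m)
  let qL ← BitReader.table 0 (fun _ => BitReader.word wN) (List.range' 2 (k - 1))
  let qR ← BitReader.table 0 (fun _ => BitReader.word wN) (List.range' 1 (k - 1))
  let dmR ← BitReader.table (0, 0) (fun i => if qR i ≠ 2 ^ wN - 1 then pair else pure (0, 0))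
    (List.range' 1 (k - 1))
  let dmL ← BitReader.table (0, 0) (fun i => if 0 < qL i then pair else pure (0, 0))
    (List.range' 2 (k - 1)).reverse
  pure { qL := qL, qR := qR, dR := fun i => (dmR i).1, mR := fun i => (dmR i).2,
         dL := fun i => (dmL i).1, mL := fun i => (dmL i).2 }

/-- First marking procedure: for `i = 1, ..., k - 1`, mark `mR i` consecutive servers, beginning
with the first server of the blocks after block `i` that is not yet marked. -/
def markRight (s : List ℝ) (k : ℕ) (a : DivideAdvice) : Finset ℕ :=
  (List.range' 1 (k - 1)).foldl (fun M i =>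
    let j := least (Finset.Ico (blockEnd s.length k i) s.length \ M)
    M ∪ Finset.Ico j (j + a.mR i)) ∅

/-- Second marking procedure: for `i = k, ..., 2`, mark `mL i` consecutive servers, going down from
the last server of the blocks before block `i` that is not yet marked. -/
def markLeft (s : List ℝ) (k : ℕ) (a : DivideAdvice) : Finset ℕ :=
  (List.range' 2 (k - 1)).reverse.foldl (fun M i =>
    let j := greatest (Finset.range (blockEnd s.length k (i - 1)) \ M)
    M ∪ Finset.Ico (j + 1 - a.mL i) (j + 1)) ∅

/-- The marked servers. -/
def marked (s : List ℝ) (k : ℕ) (a : DivideAdvice) : Finset ℕ :=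
  markRight s k a ∪ markLeft s k a

/-- A request is left unmarked (and is served inside its block), or it is marked as a request that
is to be served to the left or to the right. -/
inductive Label
  | inside
  | left
  | right
  deriving DecidableEq

/-- A request that has been served: its position, its label and its server. -/
structure Served where
  pos : ℝ
  label : Label
  server : ℕ

/-- The label of a request at `x`, given the requests served before. -/
def labelOf (s : List ℝ) (k : ℕ) (a : DivideAdvice) (log : List Served) (x : ℝ) : Label :=
  let j := blockOf s k x
  let y := trunc s x
  let same := log.filter (fun e => decide (trunc s e.pos = y))
  if 1 < j ∧ (y < a.qL j ∨
      (y = a.qL j ∧ a.dL j ≤ (same.filter (fun e => e.label ≠ Label.left)).length)) then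
    Label.left
  else if j < k ∧ (a.qR j < y ∨
      (y = a.qR j ∧ a.dR j ≤ (same.filter (fun e => e.label = Label.inside)).length)) then
    Label.right
  else Label.inside

/-- Serving an unmarked request at `x`: run `A` on the unmarked servers and the unmarked requests
of the block of `x`. -/
def serveInside (A : OnlineAlg) (s : List ℝ) (k : ℕ) (a : DivideAdvice) (log : List Served)
    (x : ℝ) : ℕ :=
  let j := blockOf s k x
  let servers := (List.range s.length).filter (fun i =>
    decide (blockEnd s.length k (j - 1) ≤ i ∧ i < blockEnd s.length k j ∧ i ∉ marked s k a))
  let past := (log.filter (fun e =>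
    decide (e.label = Label.inside ∧ blockOf s k e.pos = j))).map Served.pos
  servers.getD (A.serve (servers.map (fun i => s.getD i 0)) past x) 0

/-- Serving a marked request at `x`: run LR on the marked servers and the marked requests, with the
bit `b` on its advice tape (`b = true` for a request marked `right`). -/
def serveMarked (s : List ℝ) (k : ℕ) (a : DivideAdvice) (log : List Served)
    (b : Bool) (x : ℝ) : ℕ :=
  (lrServe s (marked s k a \ (log.map Served.server).toFinset) x).eval (fun _ => b)

/-- How DIVIDE serves a request at `x` (without reading further bits of its own tape). -/
def divideServe (A : OnlineAlg) (s : List ℝ) (k : ℕ) (a : DivideAdvice) (log : List Served)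
    (x : ℝ) : ℕ :=
  match labelOf s k a log x with
  | Label.inside => serveInside A s k a log x
  | Label.left => serveMarked s k a log false x
  | Label.right => serveMarked s k a log true x

/-- The state of DIVIDE: the servers, the advice read, and the requests served, in order of
arrival. -/
structure DivideState where
  servers : List ℝ
  advice : DivideAdvice
  log : List Served

/-- Algorithm `DIVIDE_k` with subroutine `A`. -/
def divide (k : ℕ) (A : OnlineAlg) : AdviceAlg where
  State := DivideState
  init s := do
    let a ← readAdvice s k
    pure { servers := s, advice := a, log := [] }
  step st x :=
    let j := divideServe A st.servers k st.advice st.log x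
    let e : Served :=
      { pos := x, label := labelOf st.servers k st.advice st.log x, server := j }
    pure ({ st with log := st.log ++ [e] }, j)

end LineMatching

end

/-!
Let `N` be the span of the line. Every server lies in `[1, N - 1]`, so truncating a request to
`[0, N]` changes the cost of all matchings by the same amount; hence matching the servers in
increasing order to the requests in increasing truncated position is optimal.

In this matching, at each truncated position of a block, the requests paired inside their block
form one run, preceded and followed (in the order of the pairs) by those paired to the left and to
the right. The borders of the runs are what the advice records, so whatever the order of arrival,
`DIVIDE` marks the requests like some optimal matching, and marks exactly the servers which that
matching gives to the marked requests.

Among the marked servers and requests, every request whose pair lies to its left (right) is told so,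
and an exchange argument shows that `LR` then has exactly the optimal cost. The unmarked part of
each block has at most `⌈n / k⌉` servers, so `A` pays at most `c ⌈n / k⌉` times the optimal cost of
that part, plus `α`. Since a competitive ratio is at least `1`, the marked part is absorbed, and
summing over the `k` blocks gives the bound.
-/

noncomputable section

namespace LineMatching

/-! ### Reading and writing the advice tape -/

namespace BitReader

variable {β γ : Type}

theorem eval_pure (v : β) (t : ℕ → Bool) : (pure v : BitReader β).eval t = v :=
  rfl

theorem bits_pure (v : β) (t : ℕ → Bool) : (pure v : BitReader β).bits t = 0 :=
  rfl

theorem eval_bind (p : BitReader β) (f : β → BitReader γ) (t : ℕ → Bool) :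
    (p >>= f).eval t = (f (p.eval t)).eval (fun i => t (i + p.bits t)) := by
  change (p.bind f).eval t = _
  induction p generalizing t with
  | done v => rfl
  | read _ ih => exact ih (t 0) _

theorem bits_bind (p : BitReader β) (f : β → BitReader γ) (t : ℕ → Bool) :
    (p >>= f).bits t = p.bits t + (f (p.eval t)).bits (fun i => t (i + p.bits t)) := by
  change (p.bind f).bits t = _
  induction p generalizing t with
  | done v => exact (Nat.zero_add _).symm
  | read _ ih => exact (congrArg (· + 1) (ih (t 0) _)).trans (Nat.add_right_comm _ _ _)

theorem bits_bind_le {p : BitReader β} {f : β → BitReader γ} {a b : ℕ}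
    (hp : ∀ t, p.bits t ≤ a) (hf : ∀ v t, (f v).bits t ≤ b) (t : ℕ → Bool) :
    (p >>= f).bits t ≤ a + b :=
  (bits_bind p f t).trans_le (Nat.add_le_add (hp t) (hf _ _))

theorem bits_word_le (w : ℕ) (t : ℕ → Bool) : (word w).bits t ≤ w := by
  induction w generalizing t with
  | zero => exact le_rfl
  | succ w ih =>
    exact (bits_bind_le (fun _ => le_refl 1)
      (fun b => bits_bind_le ih fun x t => (bits_pure _ t).le) t).trans_eq (Nat.add_comm 1 w)

theorem bits_table_le (dflt : β) {f : ℕ → BitReader β} {a : ℕ}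
    (h : ∀ i t, (f i).bits t ≤ a) (l : List ℕ) (t : ℕ → Bool) :
    (table dflt f l).bits t ≤ l.length * a := by
  induction l generalizing t with
  | nil => exact Nat.zero_le _
  | cons i l ih =>
    refine (bits_bind_le (h i) (fun x => bits_bind_le ih fun g t => (bits_pure _ t).le) t).trans_eq
      ?_
    rw [List.length_cons]
    ring

/-- `v` is the result of `p` on some tape: what an oracle can make the computation return. -/
def CanOutput (p : BitReader β) (v : β) : Prop :=
  ∃ t, p.eval t = v

theorem canOutput_pure (v : β) : CanOutput (pure v) v :=
  ⟨fun _ => false, rfl⟩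

theorem CanOutput.read {next : Bool → BitReader β} {v : β} (b : Bool)
    (h : CanOutput (next b) v) : CanOutput (read next) v :=
  let ⟨t, ht⟩ := h
  ⟨fun | 0 => b | i + 1 => t i, ht⟩

theorem CanOutput.bind {p : BitReader β} {f : β → BitReader γ} {v : β} {u : γ}
    (hp : CanOutput p v) (hf : CanOutput (f v) u) : CanOutput (p >>= f) u := by
  obtain ⟨t, rfl⟩ := hp
  change CanOutput (p.bind f) u
  induction p generalizing t with
  | done v => exact hf
  | read _ ih => exact (ih (t 0) (fun i => t (i + 1)) hf).read (t 0)

theorem canOutput_bit (b : Bool) : CanOutput bit b :=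
  (canOutput_pure b).read b

theorem canOutput_word {w x : ℕ} (hx : x < 2 ^ w) : CanOutput (word w) x := by
  induction w generalizing x with
  | zero =>
    obtain rfl : x = 0 := by simpa using hx
    exact canOutput_pure 0
  | succ w ih =>
    obtain ⟨b, y, hy, rfl⟩ : ∃ (b : Bool) (y : ℕ), y < 2 ^ w ∧ b.toNat * 2 ^ w + y = x := by
      rcases lt_or_ge x (2 ^ w) with h | h
      · exact ⟨false, x, h, by simp⟩
      · exact ⟨true, x - 2 ^ w, by omega, by simpa using Nat.add_sub_of_le h⟩
    exact (canOutput_bit b).bind ((ih hy).bind (canOutput_pure _))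

theorem canOutput_table {dflt : β} {f : ℕ → BitReader β} {v : ℕ → β} {l : List ℕ}
    (hmem : ∀ i ∈ l, CanOutput (f i) (v i)) (hdflt : ∀ i ∉ l, v i = dflt) :
    CanOutput (table dflt f l) v := by
  induction l generalizing v with
  | nil =>
    obtain rfl : v = fun _ => dflt := funext fun i => hdflt i List.not_mem_nil
    exact canOutput_pure _
  | cons i l ih =>
    have htail : CanOutput (table dflt f l) fun j => if j ∈ l then v j else dflt :=
      ih (fun j hj => by simpa [hj] using hmem j (by simp [hj])) fun j hj => by simp [hj]
    have hv : Function.update (fun j => if j ∈ l then v j else dflt) i (v i) = v := by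
      ext j
      by_cases hji : j = i
      · simp [hji]
      · by_cases hj : j ∈ l
        · simp [hji, hj]
        · simp [hji, hj, hdflt j (by simp [hji, hj])]
    refine (hmem i (by simp)).bind (htail.bind ?_)
    rw [hv]
    exact canOutput_pure v

end BitReader

open BitReader

/-- The number of bits of a word that stands for a position. -/
def positionWidth (s : List ℝ) : ℕ := Nat.log 2 (span s) + 1

/-- The number of bits of a word that stands for a number of requests. -/
def countWidth (s : List ℝ) : ℕ := Nat.log 2 s.length + 1

/-- The all-ones word among the positions: as a value of `qR` it says that there is no request to
be served to the right. -/
def allOnes (s : List ℝ) : ℕ := 2 ^ positionWidth s - 1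

theorem bits_readAdvice_le (s : List ℝ) (k : ℕ) (t : ℕ → Bool) :
    (readAdvice s k).bits t ≤ (k - 1) * (2 * positionWidth s + 4 * countWidth s) := by
  have hpair (p : Prop) [Decidable p] (t : ℕ → Bool) : (if p then (do
      let d ← word (countWidth s)
      let m ← word (countWidth s)
      pure (d, m)) else pure (0, 0) : BitReader (ℕ × ℕ)).bits t ≤
        countWidth s + (countWidth s + 0) := by
    split_ifs
    · exact bits_bind_le (bits_word_le _) (fun d => bits_bind_le (bits_word_le _)
        fun m t => (bits_pure _ t).le) t
    · exact Nat.zero_le _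
  refine (bits_bind_le (bits_table_le 0 (fun _ => bits_word_le _) _)
    (fun qL => bits_bind_le (bits_table_le 0 (fun _ => bits_word_le _) _)
    (fun qR => bits_bind_le (bits_table_le (0, 0) (fun i => hpair (qR i ≠ allOnes s)) _)
    (fun dmR => bits_bind_le (bits_table_le (0, 0) (fun i => hpair (0 < qL i)) _)
    (fun dmL t => (bits_pure _ t).le)))) t).trans_eq ?_
  simp only [List.length_range', List.length_reverse]
  change (k - 1) * positionWidth s + ((k - 1) * positionWidth s + _) = _
  ring

/-- `b` is a table of advice that the oracle can write: its entries fit into their words, and those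
that are not read have their default value. -/
structure IsWritable (s : List ℝ) (k : ℕ) (b : DivideAdvice) : Prop where
  qL_lt : ∀ i, b.qL i < 2 ^ positionWidth s
  qR_lt : ∀ i, b.qR i < 2 ^ positionWidth s
  dL_lt : ∀ i, b.dL i < 2 ^ countWidth s
  mL_lt : ∀ i, b.mL i < 2 ^ countWidth s
  dR_lt : ∀ i, b.dR i < 2 ^ countWidth s
  mR_lt : ∀ i, b.mR i < 2 ^ countWidth s
  qL_eq_zero : ∀ i, ¬ (1 < i ∧ i ≤ k) → b.qL i = 0
  qR_eq_zero : ∀ i, ¬ (0 < i ∧ i < k) → b.qR i = 0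
  left_unread : ∀ i, b.qL i = 0 → (b.dL i, b.mL i) = (0, 0)
  right_unread : ∀ i, ¬ (0 < i ∧ i < k) ∨ b.qR i = allOnes s → (b.dR i, b.mR i) = (0, 0)

theorem canOutput_readAdvice {s : List ℝ} {k : ℕ} {b : DivideAdvice} (hb : IsWritable s k b) :
    CanOutput (readAdvice s k) b := by
  have hpair {d m : ℕ} (hd : d < 2 ^ countWidth s) (hm : m < 2 ^ countWidth s) : CanOutput (do
      let d ← word (countWidth s)
      let m ← word (countWidth s)
      pure (d, m) : BitReader (ℕ × ℕ)) (d, m) :=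
    (canOutput_word hd).bind ((canOutput_word hm).bind (canOutput_pure _))
  have hleft {i : ℕ} (hi : i ∉ List.range' 2 (k - 1)) : b.qL i = 0 :=
    hb.qL_eq_zero i fun h => hi (List.mem_range'_1.2 (by omega))
  have hright {i : ℕ} (hi : i ∉ List.range' 1 (k - 1)) : ¬ (0 < i ∧ i < k) :=
    fun h => hi (List.mem_range'_1.2 (by omega))
  refine (canOutput_table (fun i _ => canOutput_word (hb.qL_lt i)) fun i hi => hleft hi).bind
    ((canOutput_table (fun i _ => canOutput_word (hb.qR_lt i))
      fun i hi => hb.qR_eq_zero i (hright hi)).bind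
    ((canOutput_table (v := fun i => (b.dR i, b.mR i)) (fun i _ => ?_) fun i hi => ?_).bind
    ((canOutput_table (v := fun i => (b.dL i, b.mL i)) (fun i _ => ?_) fun i hi => ?_).bind
      (canOutput_pure b))))
  · split_ifs with h
    · exact hpair (hb.dR_lt i) (hb.mR_lt i)
    · rw [hb.right_unread i (Or.inr (not_not.1 h))]
      exact canOutput_pure _
  · exact hb.right_unread i (Or.inl (hright hi))
  · split_ifs with h
    · exact hpair (hb.dL_lt i) (hb.mL_lt i)
    · rw [hb.left_unread i (Nat.eq_zero_of_not_pos h)]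
      exact canOutput_pure _
  · exact hb.left_unread i (hleft (by simpa using hi))

/-! ### Lists of reals and of indices -/

theorem exists_perm_map_eq {α β : Type*} {f : α → β} {l₁ : List β} {l₂ : List α}
    (h : l₁.Perm (l₂.map f)) : ∃ l₃ : List α, l₃.Perm l₂ ∧ l₃.map f = l₁ := by
  have hcomp : Relation.Comp (· = List.map f ·) List.Perm l₁ l₂ :=
    (congrFun₂ (List.eq_map_comp_perm f) l₁ l₂).mpr h
  obtain ⟨l₃, h₁, h₂⟩ := hcomp
  exact ⟨l₃, h₂, h₁.symm⟩

theorem perm_cons_append_cons {α : Type*} (a b : α) (l₁ l₂ : List α) :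
    (b :: (l₁ ++ a :: l₂)).Perm (a :: (l₁ ++ b :: l₂)) :=
  (List.perm_middle.cons b).trans ((List.Perm.swap a b _).trans (List.perm_middle.symm.cons a))

theorem getD_le_getD {s : List ℝ} (hs : s.Pairwise (· ≤ ·)) {i j : ℕ} (hij : i ≤ j)
    (hj : j < s.length) : s.getD i 0 ≤ s.getD j 0 := by
  rw [List.getD_eq_getElem _ _ hj, List.getD_eq_getElem _ _ (hij.trans_lt hj)]
  exact hs.sortedLE.getElem_le_getElem_of_le hij

theorem abs_sub_add_abs_sub_le {x y a b : ℝ} (hxy : x ≤ y) (hab : a ≤ b) :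
    |x - a| + |y - b| ≤ |x - b| + |y - a| := by
  grind

theorem sum_abs_sub_sorted_le {l : List (ℝ × ℝ)} {ss : List ℝ}
    (hl : (l.map Prod.fst).Pairwise (· ≤ ·)) (hs : ss.Pairwise (· ≤ ·))
    (h : (l.map Prod.snd).Perm ss) :
    (List.zipWith (fun x a => |x - a|) (l.map Prod.fst) ss).sum ≤
      (l.map fun p => |p.1 - p.2|).sum := by
  induction ss generalizing l with
  | nil =>
    obtain rfl : l = [] := by simpa using h
    simp
  | cons a ss ih =>
    rcases l with _ | ⟨⟨x, b⟩, l⟩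
    · simp at h
    simp only [List.map_cons, List.pairwise_cons] at hl hs h
    -- Exchange the partner of `x` with `a`, unless `x` has the partner `a` already.
    by_cases hab : b = a
    · subst hab
      simpa using ih hl.2 hs.2 h.cons_inv
    obtain ⟨⟨y, a'⟩, hy, rfl⟩ : ∃ p ∈ l, p.2 = a :=
      List.mem_map.1 ((List.mem_cons.1 (h.mem_iff.2 List.mem_cons_self)).resolve_left (Ne.symm hab))
    obtain ⟨l₁, l₂, rfl⟩ := List.append_of_mem hy
    have hb : b ∈ ss := (List.mem_cons.1 (h.mem_iff.1 List.mem_cons_self)).resolve_left hab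
    have hperm : ((l₁ ++ (y, b) :: l₂).map Prod.snd).Perm ss := by
      simp only [List.map_append, List.map_cons] at h ⊢
      exact ((perm_cons_append_cons b a' _ _).trans h).cons_inv
    have hexchange := abs_sub_add_abs_sub_le (hl.1 y (by simp)) (hs.1 b hb)
    have hrest := ih (l := l₁ ++ (y, b) :: l₂) (by simpa using hl.2) hs.2 hperm
    simp only [List.map_append, List.map_cons, List.sum_append, List.sum_cons,
      List.zipWith_cons_cons] at hrest ⊢
    linarith

theorem sum_map_eq_sum_blocks {α M : Type*} [AddCommMonoid M] (l : List α) (f : α → M)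
    (p : α → Prop) [DecidablePred p] (b : α → ℕ) (k : ℕ) (hb : ∀ a ∈ l, b a ∈ Finset.Icc 1 k) :
    (l.map f).sum = ∑ j ∈ Finset.Icc 1 k, ((l.filter fun a => decide (p a ∧ b a = j)).map f).sum +
      ((l.filter fun a => decide (¬ p a)).map f).sum := by
  induction l with
  | nil => simp
  | cons a l ih =>
    rw [List.map_cons, List.sum_cons, ih fun c hc => hb c (by simp [hc])]
    by_cases hp : p a
    · have hcons (j : ℕ) : (((a :: l).filter fun a => decide (p a ∧ b a = j)).map f).sum =
          (if b a = j then f a else 0) +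
            ((l.filter fun a => decide (p a ∧ b a = j)).map f).sum := by
        by_cases h : b a = j <;> simp [hp, h]
      simp only [hcons, Finset.sum_add_distrib, Finset.sum_ite_eq, hb a (by simp), if_true]
      simp [hp, add_assoc]
    · simp [hp, add_left_comm]

theorem least_mem {F : Finset ℕ} (hF : F.Nonempty) : least F ∈ F := by
  rw [least, ← Finset.coe_min' hF]
  exact F.min'_mem hF

theorem least_le {F : Finset ℕ} {i : ℕ} (hi : i ∈ F) : least F ≤ i := by
  rw [least, ← Finset.coe_min' ⟨i, hi⟩]
  exact F.min'_le i hi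

theorem greatest_mem {F : Finset ℕ} (hF : F.Nonempty) : greatest F ∈ F := by
  rw [greatest, ← Finset.coe_max' hF]
  exact F.max'_mem hF

theorem le_greatest {F : Finset ℕ} {i : ℕ} (hi : i ∈ F) : i ≤ greatest F := by
  rw [greatest, ← Finset.coe_max' ⟨i, hi⟩]
  exact F.le_max' i hi

/-! ### Algorithm LR with the directions of an optimal matching -/

theorem lrServe_left {s : List ℝ} (hs : s.Pairwise (· ≤ ·)) {F : Finset ℕ}
    (hF : ∀ j ∈ F, j < s.length) {x : ℝ} {t : ℕ} (ht : t ∈ F) (hx : s.getD t 0 < x) :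
    ∃ u ∈ F, (lrServe s F x).eval (fun _ => false) = u ∧ s.getD u 0 ∈ Set.Icc (s.getD t 0) x := by
  have htF : t ∈ F.filter fun j => s.getD j 0 < x := Finset.mem_filter.2 ⟨ht, hx⟩
  have hmem := Finset.mem_filter.1 (greatest_mem ⟨t, htF⟩)
  have hgreatest : s.getD (greatest (F.filter fun j => s.getD j 0 < x)) 0 ∈
      Set.Icc (s.getD t 0) x :=
    ⟨getD_le_getD hs (le_greatest htF) (hF _ hmem.1), hmem.2.le⟩
  simp only [lrServe, Finset.ne_empty_of_mem htF, if_false]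
  split_ifs with hequal
  · obtain ⟨hu, heq⟩ := Finset.mem_filter.1 (least_mem hequal)
    exact ⟨_, hu, rfl, hx.le.trans_eq heq.symm, heq.le⟩
  · exact ⟨_, hmem.1, rfl, hgreatest⟩
  · exact ⟨_, hmem.1, rfl, hgreatest⟩

theorem lrServe_right {s : List ℝ} (hs : s.Pairwise (· ≤ ·)) {F : Finset ℕ}
    (hF : ∀ j ∈ F, j < s.length) {x : ℝ} {t : ℕ} (ht : t ∈ F) (hx : x ≤ s.getD t 0) :
    ∃ u ∈ F, (lrServe s F x).eval (fun _ => true) = u ∧ s.getD u 0 ∈ Set.Icc x (s.getD t 0) := by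
  by_cases hequal : (F.filter fun j => s.getD j 0 = x).Nonempty
  · obtain ⟨hu, heq⟩ := Finset.mem_filter.1 (least_mem hequal)
    exact ⟨_, hu, by simp only [lrServe, hequal, if_true, eval_pure], heq.ge, heq.trans_le hx⟩
  have hlt : x < s.getD t 0 := hx.lt_of_ne fun h => hequal ⟨t, by simp [ht, h]⟩
  have htF : t ∈ F.filter fun j => x < s.getD j 0 := by simpa [ht] using hlt
  have hmem := Finset.mem_filter.1 (least_mem ⟨t, htF⟩)
  have hleast : s.getD (least (F.filter fun j => x < s.getD j 0)) 0 ∈ Set.Icc x (s.getD t 0) :=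
    ⟨hmem.2.le, getD_le_getD hs (least_le htF) (hF t ht)⟩
  simp only [lrServe, hequal, Finset.ne_empty_of_mem htF, if_false]
  split_ifs
  · exact ⟨_, hmem.1, rfl, hleast⟩
  · exact ⟨_, hmem.1, rfl, hleast⟩

/-- The servers that LR with free servers `F` assigns to a list of requests, when the bit it reads
for a request is the second component. -/
def lrRun (s : List ℝ) : Finset ℕ → List (ℝ × Bool) → List ℕ
  | _, [] => []
  | F, q :: l =>
    let u := (lrServe s F q.1).eval (fun _ => q.2)
    u :: lrRun s (F.erase u) l

theorem lrRun_append (s : List ℝ) (F : Finset ℕ) (l : List (ℝ × Bool)) (q : ℝ × Bool) :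
    lrRun s F (l ++ [q]) = lrRun s F l ++
      [(lrServe s (F \ (lrRun s F l).toFinset) q.1).eval fun _ => q.2] := by
  induction l generalizing F with
  | nil => simp [lrRun]
  | cons p l ih =>
    simp only [lrRun, List.cons_append, ih, List.toFinset_cons, Finset.sdiff_insert,
      Finset.erase_sdiff_comm]

/-- The properties of a matching which make LR reproduce its cost.  The entries are requests in
order of arrival, each with its advice bit (`true` stands for right) and the position of its
partner: the partners lie on the side of the bits, the matching is monotone on pairs with different
bits, and at each place the requests with bit `true` come first. -/
structure IsDirected (l : List ((ℝ × Bool) × ℝ)) : Prop where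
  left : ∀ e ∈ l, e.1.2 = false → e.2 < e.1.1
  right : ∀ e ∈ l, e.1.2 = true → e.1.1 ≤ e.2
  mono : ∀ e ∈ l, ∀ e' ∈ l, e.1.2 = true → e'.1.2 = false → e.1.1 < e'.1.1 → e.2 ≤ e'.2
  order : (l.map Prod.fst).Pairwise fun q q' => q.2 = false → q'.2 = true → q.1 ≠ q'.1

namespace IsDirected

theorem tail {e : (ℝ × Bool) × ℝ} {l : List ((ℝ × Bool) × ℝ)} (h : IsDirected (e :: l)) :
    IsDirected l where
  left e he := h.left e (.tail _ he)
  right e he := h.right e (.tail _ he)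
  mono e he e' he' := h.mono e (.tail _ he) e' (.tail _ he')
  order := (List.pairwise_cons.1 h.order).2

theorem order_head {e e' : (ℝ × Bool) × ℝ} {l : List ((ℝ × Bool) × ℝ)}
    (h : IsDirected (e :: l)) (he' : e' ∈ l) (hb : e.1.2 = false) (hb' : e'.1.2 = true) :
    e.1.1 ≠ e'.1.1 :=
  (List.pairwise_cons.1 h.order).1 _ (List.mem_map_of_mem he') hb hb'

variable {q q' : ℝ × Bool} {a a' : ℝ} {l l₁ l₂ : List ((ℝ × Bool) × ℝ)}

theorem eq_or_bit_eq (h : IsDirected ((q, a) :: l)) (hq' : (q', a') ∈ l)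
    (ha' : a' ∈ Set.uIcc a q.1) : a = a' ∨ q.2 = q'.2 := by
  have hhead : (q, a) ∈ (q, a) :: l := List.mem_cons_self
  have hmem : (q', a') ∈ (q, a) :: l := List.mem_cons_of_mem _ hq'
  cases hb : q.2 <;> cases hb' : q'.2
  · exact Or.inr rfl
  · rw [Set.uIcc_of_le (h.left _ hhead hb).le] at ha'
    have hle : q'.1 ≤ q.1 := (h.right _ hmem hb').trans ha'.2
    have hlt : q'.1 < q.1 := hle.lt_of_ne' (h.order_head hq' hb hb')
    exact Or.inl (le_antisymm ha'.1 (h.mono _ hmem _ hhead hb' hb hlt))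
  · rw [Set.uIcc_of_ge (h.right _ hhead hb)] at ha'
    have hlt : q.1 < q'.1 := ha'.1.trans_lt (h.left _ hmem hb')
    exact Or.inl (le_antisymm (h.mono _ hhead _ hmem hb hb' hlt) ha'.2)
  · exact Or.inr rfl

theorem swap (h : IsDirected ((q, a) :: (l₁ ++ (q', a') :: l₂))) (ha' : a' ∈ Set.uIcc a q.1) :
    IsDirected (l₁ ++ (q', a) :: l₂) := by
  have hq : (q, a) ∈ (q, a) :: (l₁ ++ (q', a') :: l₂) := List.mem_cons_self
  have hq' : (q', a') ∈ l₁ ++ (q', a') :: l₂ := by simp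
  rcases h.eq_or_bit_eq hq' ha' with rfl | hbit
  · exact h.tail
  have hmem {e : (ℝ × Bool) × ℝ} (he : e ∈ l₁ ++ (q', a) :: l₂) :
      e ∈ l₁ ++ (q', a') :: l₂ ∨ e = (q', a) := by
    simp only [List.mem_append, List.mem_cons] at he ⊢
    tauto
  have hcons {e : (ℝ × Bool) × ℝ} (he : e ∈ l₁ ++ (q', a') :: l₂) := List.mem_cons_of_mem (q, a) he
  refine ⟨fun e he hb => ?_, fun e he hb => ?_, fun e he e' he' hb hb' hlt => ?_,
    by simpa using h.tail.order⟩
  · rcases hmem he with he | rfl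
    · exact h.tail.left e he hb
    · rw [Set.uIcc_of_le (h.left _ hq (hbit.trans hb)).le] at ha'
      exact ha'.1.trans_lt (h.tail.left _ hq' hb)
  · rcases hmem he with he | rfl
    · exact h.tail.right e he hb
    · rw [Set.uIcc_of_ge (h.right _ hq (hbit.trans hb))] at ha'
      exact (h.tail.right _ hq' hb).trans ha'.2
  · rcases hmem he with he | rfl <;> rcases hmem he' with he' | rfl
    · exact h.tail.mono e he e' he' hb hb' hlt
    · have hqb := hbit.trans hb'
      rw [Set.uIcc_of_le (h.left _ hq hqb).le] at ha'
      by_contra! hae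
      have hge : q.1 ≤ e.1.1 :=
        le_of_not_gt fun hlt => (h.mono _ (hcons he) _ hq hb hqb hlt).not_gt hae
      have hgt : q.1 < e.1.1 := hge.lt_of_ne (h.order_head he hqb hb)
      linarith [h.tail.mono _ he _ hq' hb hb' hlt, h.tail.right _ he hb, ha'.2]
    · have hqb := hbit.trans hb
      rw [Set.uIcc_of_ge (h.right _ hq hqb)] at ha'
      by_contra! hae
      have hge : e'.1.1 ≤ q.1 :=
        le_of_not_gt fun hlt => (h.mono _ hq _ (hcons he') hqb hb' hlt).not_gt hae
      linarith [h.tail.mono _ hq' _ he' hb hb' hlt, h.tail.left _ he' hb', ha'.1]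
    · exact le_rfl

theorem abs_swap (h : IsDirected ((q, a) :: l)) (hq' : (q', a') ∈ l)
    (ha' : a' ∈ Set.uIcc a q.1) : |q.1 - a'| + |q'.1 - a| = |q.1 - a| + |q'.1 - a'| := by
  rcases h.eq_or_bit_eq hq' ha' with rfl | hbit
  · rfl
  cases hb : q.2
  · have ha := h.left _ List.mem_cons_self hb
    have hle := h.tail.left _ hq' (hbit.symm.trans hb)
    rw [Set.uIcc_of_le ha.le] at ha'
    rw [abs_of_nonneg, abs_of_nonneg, abs_of_nonneg, abs_of_nonneg] <;> linarith [ha'.1, ha'.2]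
  · have ha := h.right _ List.mem_cons_self hb
    have hle := h.tail.right _ hq' (hbit.symm.trans hb)
    rw [Set.uIcc_of_ge ha] at ha'
    rw [abs_of_nonpos, abs_of_nonpos, abs_of_nonpos, abs_of_nonpos] <;> linarith [ha'.1, ha'.2]

end IsDirected

/-- The entry of a matching in which the index of the partner is replaced by its position. -/
def locate (s : List ℝ) (e : (ℝ × Bool) × ℕ) : (ℝ × Bool) × ℝ := (e.1, s.getD e.2 0)

theorem lrServe_mem_uIcc {s : List ℝ} (hs : s.Pairwise (· ≤ ·)) {F : Finset ℕ}
    (hF : ∀ j ∈ F, j < s.length) {e : (ℝ × Bool) × ℕ} {l : List ((ℝ × Bool) × ℕ)} (he : e.2 ∈ F)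
    (h : IsDirected ((e :: l).map (locate s))) :
    ∃ u ∈ F, (lrServe s F e.1.1).eval (fun _ => e.1.2) = u ∧
      s.getD u 0 ∈ Set.uIcc (s.getD e.2 0) e.1.1 := by
  cases hb : e.1.2
  · obtain ⟨u, hu, heval, hmem⟩ := lrServe_left hs hF he (h.left _ List.mem_cons_self hb)
    exact ⟨u, hu, heval, Set.Icc_subset_uIcc hmem⟩
  · obtain ⟨u, hu, heval, hmem⟩ := lrServe_right hs hF he (h.right _ List.mem_cons_self hb)
    exact ⟨u, hu, heval, Set.Icc_subset_uIcc' hmem⟩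

theorem IsDirected.exists_exchange {s : List ℝ} {e : (ℝ × Bool) × ℕ}
    {l : List ((ℝ × Bool) × ℕ)} {u : ℕ} (h : IsDirected ((e :: l).map (locate s)))
    (hu : u ∈ (e :: l).map Prod.snd) (hus : s.getD u 0 ∈ Set.uIcc (s.getD e.2 0) e.1.1) :
    ∃ l' : List ((ℝ × Bool) × ℕ), l'.map Prod.fst = l.map Prod.fst ∧
      ((e :: l).map Prod.snd).Perm (u :: l'.map Prod.snd) ∧ IsDirected (l'.map (locate s)) ∧
      ((e :: l).map fun e => |e.1.1 - s.getD e.2 0|).sum =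
        |e.1.1 - s.getD u 0| + (l'.map fun e => |e.1.1 - s.getD e.2 0|).sum := by
  rw [List.map_cons] at hu
  rcases List.mem_cons.1 hu with rfl | hu
  · exact ⟨l, rfl, .refl _, h.tail, rfl⟩
  obtain ⟨⟨q', _⟩, hq', rfl⟩ := List.mem_map.1 hu
  obtain ⟨l₁, l₂, rfl⟩ := List.append_of_mem hq'
  have habs := h.abs_swap (List.mem_map_of_mem hq') hus
  rw [List.map_cons, List.map_append, List.map_cons] at h
  refine ⟨l₁ ++ (q', e.2) :: l₂, by simp, ?_, ?_, ?_⟩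
  · simpa using perm_cons_append_cons _ _ _ _
  · simpa [locate] using h.swap hus
  · simp only [List.map_append, List.map_cons, List.sum_append, List.sum_cons] at habs ⊢
    linarith

theorem lrRun_perm_and_cost {s : List ℝ} (hs : s.Pairwise (· ≤ ·)) {l : List ((ℝ × Bool) × ℕ)}
    (hl : IsDirected (l.map (locate s))) (hnodup : (l.map Prod.snd).Nodup)
    (hlt : ∀ j ∈ l.map Prod.snd, j < s.length) :
    (lrRun s (l.map Prod.snd).toFinset (l.map Prod.fst)).Perm (l.map Prod.snd) ∧
      (List.zipWith (fun q j => |q.1 - s.getD j 0|) (l.map Prod.fst)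
        (lrRun s (l.map Prod.snd).toFinset (l.map Prod.fst))).sum =
      (l.map fun e => |e.1.1 - s.getD e.2 0|).sum := by
  induction hqs : l.map Prod.fst generalizing l with
  | nil =>
    obtain rfl : l = [] := List.map_eq_nil_iff.1 hqs
    simp [lrRun]
  | cons q qs ih =>
    obtain ⟨e, l, rfl, rfl, htail⟩ := List.map_eq_cons_iff.1 hqs
    obtain ⟨u, hu, heval, hus⟩ := lrServe_mem_uIcc (F := ((e :: l).map Prod.snd).toFinset) hs
      (fun j hj => hlt j (List.mem_toFinset.1 hj)) (by simp) hl
    obtain ⟨l', hfst, hperm, hl', hcost⟩ := hl.exists_exchange (List.mem_toFinset.1 hu) hus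
    have hnodup' := List.nodup_cons.1 (hperm.nodup_iff.1 hnodup)
    have hfree : ((e :: l).map Prod.snd).toFinset.erase u = (l'.map Prod.snd).toFinset := by
      rw [List.toFinset_eq_of_perm _ _ hperm, List.toFinset_cons, Finset.erase_insert]
      exact fun h => hnodup'.1 (List.mem_toFinset.1 h)
    obtain ⟨ihperm, ihcost⟩ := ih hl' hnodup'.2
      (fun j hj => hlt j (hperm.mem_iff.2 (List.mem_cons_of_mem u hj))) (hfst.trans htail)
    rw [lrRun, heval, hfree]
    exact ⟨(ihperm.cons u).trans hperm.symm, by rw [List.zipWith_cons_cons, List.sum_cons, ihcost,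
      hcost]⟩

/-! ### Blocks -/

theorem blockEnd_zero (n k : ℕ) : blockEnd n k 0 = 0 := by simp [blockEnd]

theorem blockEnd_self {n k : ℕ} (hk : 0 < k) : blockEnd n k k = n := by
  rw [blockEnd, min_eq_right (Nat.mod_lt n hk).le, Nat.div_add_mod]

theorem blockEnd_mono (n k : ℕ) : Monotone (blockEnd n k) := fun _ _ hij =>
  Nat.add_le_add (Nat.mul_le_mul_right _ hij) (min_le_min_right _ hij)

theorem blockEnd_lt {n k i j : ℕ} (hk : 0 < k) (hkn : k ≤ n) (hij : i < j) :
    blockEnd n k i < blockEnd n k j :=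
  Nat.add_lt_add_of_lt_of_le (Nat.mul_lt_mul_of_pos_right hij (Nat.div_pos hkn hk))
    (min_le_min_right _ hij.le)

theorem blockEnd_sub_le {n k j : ℕ} (hk : 0 < k) (hj : 1 ≤ j) :
    blockEnd n k j - blockEnd n k (j - 1) ≤ ⌈(n : ℝ) / k⌉₊ := by
  obtain ⟨i, rfl⟩ := Nat.exists_eq_add_of_le' hj
  have hn : n ≤ ⌈(n : ℝ) / k⌉₊ * k := by
    have h := Nat.le_ceil ((n : ℝ) / k)
    rw [div_le_iff₀ (by exact_mod_cast hk)] at h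
    exact_mod_cast h
  have hdiv : n / k + min 1 (n % k) ≤ ⌈(n : ℝ) / k⌉₊ := by
    by_contra! hlt
    have hle := Nat.mul_le_mul_right k (Nat.le_of_lt_succ (hlt.trans_le (by omega : _ ≤ n / k + 1)))
    have hmod := Nat.div_add_mod' n k
    have h0 : n % k = 0 := by omega
    rw [h0, min_eq_right zero_le_one, add_zero] at hlt
    have := Nat.mul_lt_mul_of_pos_right hlt hk
    omega
  rw [Nat.add_sub_cancel, blockEnd, blockEnd, Nat.add_one_mul]
  omega

section Blocks

variable {s : List ℝ} {k : ℕ}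

theorem one_le_blockOf (hk : 0 < k) (x : ℝ) : 1 ≤ blockOf s k x := by
  unfold blockOf
  cases hfind : (List.range' 1 (k - 1)).find? (fun i => decide (x ≤ border s k i)) with
  | none => exact hk
  | some i => exact (List.mem_range'_1.1 (List.mem_of_find?_eq_some hfind)).1

theorem blockOf_le (hk : 0 < k) (x : ℝ) : blockOf s k x ≤ k := by
  unfold blockOf
  cases hfind : (List.range' 1 (k - 1)).find? (fun i => decide (x ≤ border s k i)) with
  | none => exact le_rfl
  | some i =>
    have := List.mem_range'_1.1 (List.mem_of_find?_eq_some hfind)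
    rw [Option.getD_some]
    omega

theorem border_lt_of_one_lt_blockOf (hk : 0 < k) {x : ℝ} (hx : 1 < blockOf s k x) :
    border s k (blockOf s k x - 1) < x := by
  have hle := blockOf_le (s := s) hk x
  unfold blockOf at hx hle ⊢
  cases hfind : (List.range' 1 (k - 1)).find? (fun i => decide (x ≤ border s k i)) with
  | none =>
    rw [hfind, Option.getD_none] at hx
    simpa using List.find?_eq_none.1 hfind (k - 1) (List.mem_range'_1.2 (by omega))
  | some i =>
    rw [hfind, Option.getD_some] at hx
    simpa using (List.find?_range'_eq_some.1 hfind).2.2 (i - 1) (by omega) (by omega)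

theorem le_border_of_blockOf_lt {x : ℝ} (hx : blockOf s k x < k) :
    x ≤ border s k (blockOf s k x) := by
  unfold blockOf at hx ⊢
  cases hfind : (List.range' 1 (k - 1)).find? (fun i => decide (x ≤ border s k i)) with
  | none => simp [hfind] at hx
  | some i => simpa using List.find?_some hfind

/-- The servers are sorted and lie between `1` and `N - 1`, and there are at least `k ≥ 1` of
them. -/
structure IsLine (s : List ℝ) (k : ℕ) : Prop where
  sorted : s.Pairwise (· ≤ ·)
  pos : 0 < k
  le_length : k ≤ s.length
  one_le : ∀ i < s.length, 1 ≤ s.getD i 0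
  le_span : ∀ i < s.length, s.getD i 0 ≤ span s - 1

namespace IsLine

theorem blockEnd_pos (h : IsLine s k) {i : ℕ} (hi : 0 < i) : 0 < blockEnd s.length k i := by
  simpa [blockEnd_zero] using blockEnd_lt h.pos h.le_length hi

theorem blockEnd_lt_length (h : IsLine s k) {i : ℕ} (hi : i < k) :
    blockEnd s.length k i < s.length := by
  simpa [blockEnd_self h.pos] using blockEnd_lt h.pos h.le_length hi

theorem le_border (h : IsLine s k) {i t : ℕ} (hi : i < k) (ht : t < blockEnd s.length k i) :
    s.getD t 0 ≤ border s k i := by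
  have hlt := h.blockEnd_lt_length hi
  have hlast := getD_le_getD h.sorted (i := t) (j := blockEnd s.length k i - 1) (by omega)
    (by omega)
  have hnext := getD_le_getD h.sorted ht.le hlt
  unfold border
  linarith

theorem border_le (h : IsLine s k) {i t : ℕ} (ht : blockEnd s.length k i ≤ t)
    (hts : t < s.length) : border s k i ≤ s.getD t 0 := by
  have hlast := getD_le_getD h.sorted (i := blockEnd s.length k i - 1) (j := t) (by omega) hts
  have hnext := getD_le_getD h.sorted ht hts
  unfold border
  linarith

theorem border_mono (h : IsLine s k) {i j : ℕ} (hij : i ≤ j) (hj : j < k) :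
    border s k i ≤ border s k j := by
  rcases hij.eq_or_lt with rfl | hlt
  · exact le_rfl
  · exact (h.border_le le_rfl (h.blockEnd_lt_length (hlt.trans hj))).trans
      (h.le_border hj (blockEnd_lt h.pos h.le_length hlt))

theorem one_le_border (h : IsLine s k) {i : ℕ} (hi : 0 < i) (hik : i < k) :
    1 ≤ border s k i :=
  (h.one_le 0 (h.pos.trans_le h.le_length)).trans (h.le_border hik (h.blockEnd_pos hi))

theorem border_le_span (h : IsLine s k) {i : ℕ} (hik : i < k) :
    border s k i ≤ span s - 1 :=
  (h.border_le le_rfl (h.blockEnd_lt_length hik)).trans (h.le_span _ (h.blockEnd_lt_length hik))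

theorem blockOf_le_blockOf (h : IsLine s k) {x x' : ℝ}
    (hx : ∀ i, 0 < i → i < k → x' ≤ border s k i → x ≤ border s k i) :
    blockOf s k x ≤ blockOf s k x' := by
  by_contra! hlt
  have hpos := one_le_blockOf (s := s) h.pos x'
  have hle := blockOf_le (s := s) h.pos x
  have hx' := hx _ hpos (by omega) (le_border_of_blockOf_lt (by omega))
  have hborder := border_lt_of_one_lt_blockOf (s := s) (x := x) h.pos (by omega)
  exact (hx'.trans (h.border_mono (by omega) (by omega))).not_gt hborder

theorem blockOf_mono (h : IsLine s k) : Monotone (blockOf s k) := fun _ _ hx =>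
  h.blockOf_le_blockOf fun _ _ _ => hx.trans

theorem blockOf_trunc (h : IsLine s k) (x : ℝ) : blockOf s k (trunc s x) = blockOf s k x := by
  apply le_antisymm <;> refine h.blockOf_le_blockOf fun i hi hik hx => ?_
  · exact max_le (zero_le_one.trans (h.one_le_border hi hik)) ((min_le_right _ _).trans hx)
  · refine (min_le_iff.1 ((le_max_right _ _).trans hx)).resolve_left (not_le_of_gt ?_)
    exact (h.border_le_span hik).trans_lt (sub_one_lt _)

end IsLine

end Blocks

/-! ### The marking procedures -/

theorem Ico_least_add_card {S D : Finset ℕ} (hDS : D ⊆ S)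
    (hinitial : ∀ d ∈ D, ∀ t ∈ S, t ≤ d → t ∈ D) (hconn : (D : Set ℕ).OrdConnected) :
    Finset.Ico (least S) (least S + D.card) = D := by
  rcases D.eq_empty_or_nonempty with rfl | hne
  · simp
  obtain ⟨d, hd⟩ := hne
  have hleast : least S ∈ D :=
    hinitial d hd _ (least_mem ⟨d, hDS hd⟩) (least_le (hDS hd))
  have hD : D = Finset.Ico (least S) (greatest D + 1) := by
    ext t
    rw [Finset.mem_Ico, Nat.lt_succ_iff]
    exact ⟨fun ht => ⟨least_le (hDS ht), le_greatest ht⟩,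
      fun ht => hconn.out hleast (greatest_mem ⟨d, hd⟩) ht⟩
  have hle : least S ≤ greatest D := le_greatest hleast
  conv_rhs => rw [hD]
  rw [congrArg Finset.card hD, Nat.card_Ico]
  congr 1
  omega

theorem Ico_greatest_sub_card {S D : Finset ℕ} (hDS : D ⊆ S)
    (hfinal : ∀ d ∈ D, ∀ t ∈ S, d ≤ t → t ∈ D) (hconn : (D : Set ℕ).OrdConnected) :
    Finset.Ico (greatest S + 1 - D.card) (greatest S + 1) = D := by
  rcases D.eq_empty_or_nonempty with rfl | hne
  · simp
  obtain ⟨d, hd⟩ := hne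
  have hgreatest : greatest S ∈ D :=
    hfinal d hd _ (greatest_mem ⟨d, hDS hd⟩) (le_greatest (hDS hd))
  have hD : D = Finset.Ico (least D) (greatest S + 1) := by
    ext t
    rw [Finset.mem_Ico, Nat.lt_succ_iff]
    exact ⟨fun ht => ⟨least_le ht, le_greatest (hDS ht)⟩,
      fun ht => hconn.out (least_mem ⟨d, hd⟩) hgreatest ht⟩
  have hle : least D ≤ greatest S := least_le hgreatest
  conv_rhs => rw [hD]
  rw [congrArg Finset.card hD, Nat.card_Ico]
  congr 1
  omega

section Marking

variable {n k : ℕ} {e β m : ℕ → ℕ}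

theorem foldl_markRight (he : Monotone e) (hβ : MonotoneOn β (Set.Iio n))
    (hβpos : ∀ t < n, 1 ≤ β t) {q : ℕ}
    (hm : ∀ i ∈ Finset.Icc 1 q, m i = ((Finset.range n).filter fun t => β t = i ∧ e i ≤ t).card) :
    (List.range' 1 q).foldl (fun M i =>
      let j := least (Finset.Ico (e i) n \ M)
      M ∪ Finset.Ico j (j + m i)) ∅ =
    (Finset.range n).filter fun t => e (β t) ≤ t ∧ β t ≤ q := by
  induction q with
  | zero =>
    refine (Finset.filter_eq_empty_iff.2 fun t ht h => ?_).symm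
    exact absurd (hβpos t (Finset.mem_range.1 ht)) (by omega)
  | succ q ih =>
    rw [List.range'_1_concat, List.foldl_append,
      ih fun i hi => hm i (Finset.Icc_subset_Icc_right q.le_succ hi)]
    simp only [List.foldl_cons, List.foldl_nil, add_comm 1 q]
    rw [hm (q + 1) (by simp), Ico_least_add_card]
    · ext t
      simp only [Finset.mem_union, Finset.mem_filter]
      grind
    · intro t
      simp only [Finset.mem_sdiff, Finset.mem_Ico, Finset.mem_filter, Finset.mem_range]
      omega
    · intro d hd t ht htd
      simp only [Finset.mem_sdiff, Finset.mem_Ico, Finset.mem_filter, Finset.mem_range] at hd ht ⊢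
      have hle := hβ (Set.mem_Iio.2 ht.1.2) (Set.mem_Iio.2 hd.1) htd
      have hnot : ¬ β t ≤ q := fun h => ht.2 ⟨ht.1.2, (he (by omega)).trans ht.1.1, h⟩
      omega
    · refine ⟨fun a ha b hb t ht => ?_⟩
      simp only [Finset.coe_filter, Finset.mem_range, Set.mem_ofPred_eq] at ha hb ⊢
      have htn := ht.2.trans_lt hb.1
      have hat := hβ (Set.mem_Iio.2 ha.1) (Set.mem_Iio.2 htn) ht.1
      have htb := hβ (Set.mem_Iio.2 htn) (Set.mem_Iio.2 hb.1) ht.2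
      exact ⟨htn, by omega, ha.2.2.trans ht.1⟩

theorem foldl_markLeft (he : Monotone e) (hβ : MonotoneOn β (Set.Iio n)) (hek : e k ≤ n)
    (hβk : ∀ t < n, β t ≤ k) {q : ℕ} (hq : q < k)
    (hm : ∀ i ∈ Finset.Ioc (k - q) k,
      m i = ((Finset.range n).filter fun t => β t = i ∧ t < e (i - 1)).card) :
    (List.range' (k + 1 - q) q).reverse.foldl (fun M i =>
      let j := greatest (Finset.range (e (i - 1)) \ M)
      M ∪ Finset.Ico (j + 1 - m i) (j + 1)) ∅ =
    (Finset.range n).filter fun t => t < e (β t - 1) ∧ k + 1 - q ≤ β t := by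
  induction q with
  | zero =>
    refine (Finset.filter_eq_empty_iff.2 fun t ht h => ?_).symm
    exact absurd (hβk t (Finset.mem_range.1 ht)) (by omega)
  | succ q ih =>
    obtain ⟨i, hi, hi'⟩ : ∃ i, k + 1 - (q + 1) = i ∧ k + 1 - q = i + 1 :=
      ⟨k - q, by omega, by omega⟩
    rw [hi, List.range'_succ, List.reverse_cons, List.foldl_append, ← hi',
      ih (by omega) fun j hj => hm j (Finset.Ioc_subset_Ioc_left (by omega) hj), hi']
    simp only [List.foldl_cons, List.foldl_nil]
    have hlt {t : ℕ} (ht : t < e (i - 1)) : t < n := ht.trans_le ((he (by omega)).trans hek)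
    rw [hm i (Finset.mem_Ioc.2 (by omega)), Ico_greatest_sub_card]
    · ext t
      simp only [Finset.mem_union, Finset.mem_filter]
      grind
    · intro t
      simp only [Finset.mem_sdiff, Finset.mem_filter, Finset.mem_range]
      omega
    · intro d hd t ht hdt
      simp only [Finset.mem_sdiff, Finset.mem_filter, Finset.mem_range] at hd ht ⊢
      have hle := hβ (Set.mem_Iio.2 hd.1) (Set.mem_Iio.2 (hlt ht.1)) hdt
      have hnot : ¬ i + 1 ≤ β t := fun h => ht.2 ⟨hlt ht.1, ht.1.trans_le (he (by omega)), h⟩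
      exact ⟨hlt ht.1, by omega, ht.1⟩
    · refine ⟨fun a ha b hb t ht => ?_⟩
      simp only [Finset.coe_filter, Finset.mem_range, Set.mem_ofPred_eq] at ha hb ⊢
      have htn := ht.2.trans_lt hb.1
      have hat := hβ (Set.mem_Iio.2 ha.1) (Set.mem_Iio.2 htn) ht.1
      have htb := hβ (Set.mem_Iio.2 htn) (Set.mem_Iio.2 hb.1) ht.2
      exact ⟨htn, by omega, ht.2.trans_lt hb.2.2⟩

end Marking

/-! ### The sorted matching -/

/-- The block that contains the `t`-th request from the left, when `p` lists the truncated positions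
of the requests in increasing order. -/
def pairBlock (s : List ℝ) (k : ℕ) (p : ℕ → ℕ) (t : ℕ) : ℕ := blockOf s k (p t)

/-- The side on which the pair of the `t`-th request from the left lies in the sorted matching,
where this pair is the `t`-th server: in the block of the request, or in an earlier or a later
one. -/
def pairLabel (s : List ℝ) (k : ℕ) (p : ℕ → ℕ) (t : ℕ) : Label :=
  if t < blockEnd s.length k (pairBlock s k p t - 1) then Label.left
  else if blockEnd s.length k (pairBlock s k p t) ≤ t then Label.right
  else Label.inside

/-- The positions of the requests with the labels of the sorted matching, from left to right. -/
def pairList (s : List ℝ) (k : ℕ) (p : ℕ → ℕ) : List (ℝ × Label) :=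
  (List.range s.length).map fun t => ((p t : ℝ), pairLabel s k p t)

/-- The requests of block `j` that have the label `b` in the sorted matching. -/
def labelledIn (s : List ℝ) (k : ℕ) (p : ℕ → ℕ) (j : ℕ) (b : Label) : Finset ℕ :=
  (Finset.range s.length).filter fun t => pairBlock s k p t = j ∧ pairLabel s k p t = b

/-- The position of the rightmost request of block `j` whose pair is in an earlier block (`0` if
there is none). -/
def rightmostLeft (s : List ℝ) (k : ℕ) (p : ℕ → ℕ) (j : ℕ) : ℕ :=
  (labelledIn s k p j Label.left).sup p

/-- The position of the leftmost request of block `j` whose pair is in a later block (the all-ones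
word if there is none). -/
def leftmostRight (s : List ℝ) (k : ℕ) (p : ℕ → ℕ) (j : ℕ) : ℕ :=
  sInf (insert (allOnes s) (p '' (labelledIn s k p j Label.right : Set ℕ)))

/-- What the oracle writes on the advice tape when `p` lists the truncated positions of the requests
in increasing order.  It uses the sorted matching as the optimal one. -/
def oracleAdvice (s : List ℝ) (k : ℕ) (p : ℕ → ℕ) : DivideAdvice where
  qL j := rightmostLeft s k p j
  qR j := if 0 < j ∧ j < k then leftmostRight s k p j else 0
  dR j := if labelledIn s k p j Label.right = ∅ then 0 else
    (pairList s k p).count ((leftmostRight s k p j : ℝ), Label.inside)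
  mR j := (labelledIn s k p j Label.right).card
  dL j := if labelledIn s k p j Label.left = ∅ then 0 else
    (pairList s k p).count ((rightmostLeft s k p j : ℝ), Label.inside) +
      (pairList s k p).count ((rightmostLeft s k p j : ℝ), Label.right)
  mL j := (labelledIn s k p j Label.left).card

section SortedMatching

variable {s : List ℝ} {k : ℕ} {p : ℕ → ℕ} {t u : ℕ}

theorem pairLabel_eq_left : pairLabel s k p t = Label.left ↔
    t < blockEnd s.length k (pairBlock s k p t - 1) := by
  unfold pairLabel
  split_ifs <;> simp_all

theorem pairLabel_eq_right : pairLabel s k p t = Label.right ↔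
    blockEnd s.length k (pairBlock s k p t) ≤ t := by
  have hle := blockEnd_mono s.length k (Nat.sub_le (pairBlock s k p t) 1)
  unfold pairLabel
  split_ifs with hleft
  · simp only [false_iff, not_le]
    omega
  all_goals simp_all

theorem pairLabel_eq_inside : pairLabel s k p t = Label.inside ↔
    blockEnd s.length k (pairBlock s k p t - 1) ≤ t ∧
      t < blockEnd s.length k (pairBlock s k p t) := by
  unfold pairLabel
  split_ifs <;> simp_all

theorem pairBlock_mono (hs : IsLine s k) (hp : Monotone p) : Monotone (pairBlock s k p) :=
  fun _ _ h => hs.blockOf_mono (Nat.cast_le.2 (hp h))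

theorem one_le_pairBlock (hs : IsLine s k) (p : ℕ → ℕ) (t : ℕ) : 1 ≤ pairBlock s k p t :=
  one_le_blockOf hs.pos _

theorem pairBlock_le (hs : IsLine s k) (p : ℕ → ℕ) (t : ℕ) : pairBlock s k p t ≤ k :=
  blockOf_le hs.pos _

theorem one_lt_pairBlock (h : pairLabel s k p t = Label.left) : 1 < pairBlock s k p t := by
  rw [pairLabel_eq_left] at h
  by_contra! hle
  rw [Nat.sub_eq_zero_of_le hle, blockEnd_zero] at h
  omega

theorem pairBlock_lt (hs : IsLine s k) (ht : t < s.length) (h : pairLabel s k p t = Label.right) :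
    pairBlock s k p t < k := by
  rw [pairLabel_eq_right] at h
  refine (pairBlock_le hs p t).lt_of_ne fun heq => ?_
  rw [heq, blockEnd_self hs.pos] at h
  omega

theorem pos_of_one_lt_pairBlock (hs : IsLine s k) (h : 1 < pairBlock s k p t) : 0 < p t := by
  have hle := pairBlock_le hs p t
  have hborder := hs.one_le_border (i := pairBlock s k p t - 1) (by omega) (by omega)
  have hlt := border_lt_of_one_lt_blockOf hs.pos h
  exact_mod_cast (zero_lt_one.trans_le hborder).trans hlt

theorem lt_span_of_pairBlock_lt (hs : IsLine s k) (h : pairBlock s k p t < k) : p t < span s := by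
  have hle := (le_border_of_blockOf_lt h).trans (hs.border_le_span h)
  exact_mod_cast hle.trans_lt (sub_one_lt _)

theorem mem_labelledIn {j : ℕ} {b : Label} : t ∈ labelledIn s k p j b ↔
    t < s.length ∧ pairBlock s k p t = j ∧ pairLabel s k p t = b := by
  simp [labelledIn]

theorem labelledIn_left (j : ℕ) : labelledIn s k p j Label.left =
    (Finset.range s.length).filter fun t =>
      pairBlock s k p t = j ∧ t < blockEnd s.length k (j - 1) :=
  Finset.filter_congr fun t _ => and_congr_right fun h => by rw [← h, pairLabel_eq_left]

theorem labelledIn_right (j : ℕ) : labelledIn s k p j Label.right =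
    (Finset.range s.length).filter fun t => pairBlock s k p t = j ∧ blockEnd s.length k j ≤ t :=
  Finset.filter_congr fun t _ => and_congr_right fun h => by rw [← h, pairLabel_eq_right]

theorem mem_pairList {x : ℝ × Label} : x ∈ pairList s k p ↔
    ∃ t < s.length, (p t : ℝ) = x.1 ∧ pairLabel s k p t = x.2 := by
  simp only [pairList, List.mem_map, List.mem_range, Prod.ext_iff]

theorem count_pairList_eq_zero {b : Label}
    (h : ∀ u < s.length, p u = p t → pairLabel s k p u ≠ b) :
    (pairList s k p).count ((p t : ℝ), b) = 0 := by
  rw [List.count_eq_zero, mem_pairList]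
  rintro ⟨u, hu, hpos, hb⟩
  exact h u hu (Nat.cast_injective hpos) hb

theorem map_fst_pairList :
    (pairList s k p).map Prod.fst = (List.range s.length).map fun t => (p t : ℝ) := by
  simp [pairList, Function.comp_def]

theorem count_map_fst (l : List (ℝ × Label)) (y : ℝ) : (l.map Prod.fst).count y =
    l.count (y, Label.left) + l.count (y, Label.inside) + l.count (y, Label.right) := by
  induction l with
  | nil => rfl
  | cons e l ih =>
    obtain ⟨x, b⟩ := e
    by_cases hx : x = y <;> cases b <;> simp [hx] at ih ⊢ <;> omega

/-! ### The advice of the oracle -/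

theorem span_le_allOnes (s : List ℝ) : span s ≤ allOnes s :=
  Nat.le_pred_of_lt (Nat.lt_pow_succ_log_self one_lt_two _)

theorem le_rightmostLeft {j : ℕ} (h : t ∈ labelledIn s k p j Label.left) :
    p t ≤ rightmostLeft s k p j :=
  Finset.le_sup h

theorem leftmostRight_le {j : ℕ} (h : t ∈ labelledIn s k p j Label.right) :
    leftmostRight s k p j ≤ p t :=
  Nat.sInf_le (Or.inr ⟨t, h, rfl⟩)

theorem leftmostRight_le_allOnes (j : ℕ) : leftmostRight s k p j ≤ allOnes s :=
  Nat.sInf_le (Set.mem_insert _ _)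

theorem rightmostLeft_eq_zero_iff (hs : IsLine s k) {j : ℕ} :
    rightmostLeft s k p j = 0 ↔ labelledIn s k p j Label.left = ∅ := by
  refine ⟨fun h => Finset.eq_empty_of_forall_notMem fun t ht => ?_, fun h => by
    simp [rightmostLeft, h]⟩
  have hpos := pos_of_one_lt_pairBlock hs (one_lt_pairBlock (mem_labelledIn.1 ht).2.2)
  exact ((le_rightmostLeft ht).trans_eq h).not_gt hpos

theorem leftmostRight_eq_allOnes_iff (hs : IsLine s k) {j : ℕ} :
    leftmostRight s k p j = allOnes s ↔ labelledIn s k p j Label.right = ∅ := by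
  refine ⟨fun h => Finset.eq_empty_of_forall_notMem fun t ht => ?_, fun h => by
    simp [leftmostRight, h]⟩
  obtain ⟨hlt, -, hright⟩ := mem_labelledIn.1 ht
  have hspan := lt_span_of_pairBlock_lt hs (pairBlock_lt hs hlt hright)
  exact ((h ▸ leftmostRight_le ht).trans_lt hspan).not_ge (span_le_allOnes s)

theorem pairLabel_eq_left_of_lt_rightmostLeft (hp : Monotone p)
    (h : p t < rightmostLeft s k p (pairBlock s k p t)) : pairLabel s k p t = Label.left := by
  rw [rightmostLeft, Finset.lt_sup_iff] at h
  obtain ⟨u, hu, hut⟩ := h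
  obtain ⟨-, hblock, hleft⟩ := mem_labelledIn.1 hu
  rw [pairLabel_eq_left] at hleft ⊢
  exact (hp.reflect_lt hut).trans (hblock ▸ hleft)

theorem pairLabel_eq_right_of_leftmostRight_lt (hp : Monotone p) (ht : p t ≤ span s)
    (h : leftmostRight s k p (pairBlock s k p t) < p t) : pairLabel s k p t = Label.right := by
  obtain ⟨q, hq, hqt⟩ := (csInf_lt_iff (OrderBot.bddBelow _) (Set.insert_nonempty _ _)).1 h
  rcases hq with rfl | ⟨u, hu, rfl⟩
  · exact absurd (hqt.trans_le ht) (span_le_allOnes s).not_gt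
  · obtain ⟨-, hblock, hright⟩ := mem_labelledIn.1 hu
    rw [pairLabel_eq_right] at hright ⊢
    exact (hblock ▸ hright).trans (hp.reflect_lt hqt).le

theorem isWritable_oracleAdvice (hs : IsLine s k) (hspan : ∀ t, p t ≤ span s) :
    IsWritable s k (oracleAdvice s k p) := by
  have hall : allOnes s < 2 ^ positionWidth s := Nat.sub_lt (by positivity) one_pos
  have hlength : s.length < 2 ^ countWidth s := Nat.lt_pow_succ_log_self one_lt_two _
  have hcard (j : ℕ) (b : Label) : (labelledIn s k p j b).card ≤ s.length :=
    (Finset.card_filter_le _ _).trans_eq (Finset.card_range _)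
  have hcount (y : ℝ) : (pairList s k p).count (y, Label.inside) +
      (pairList s k p).count (y, Label.right) ≤ s.length := by
    have hle := List.count_le_length (a := y) (l := (pairList s k p).map Prod.fst)
    rw [count_map_fst, map_fst_pairList, List.length_map, List.length_range] at hle
    omega
  have hleft (j : ℕ) (hj : ¬ (1 < j ∧ j ≤ k)) : labelledIn s k p j Label.left = ∅ := by
    refine Finset.eq_empty_of_forall_notMem fun t ht => hj ?_
    obtain ⟨-, rfl, h⟩ := mem_labelledIn.1 ht
    exact ⟨one_lt_pairBlock h, pairBlock_le hs p t⟩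
  have hright (j : ℕ) (hj : ¬ (0 < j ∧ j < k)) : labelledIn s k p j Label.right = ∅ := by
    refine Finset.eq_empty_of_forall_notMem fun t ht => hj ?_
    obtain ⟨hlt, rfl, h⟩ := mem_labelledIn.1 ht
    exact ⟨one_le_pairBlock hs p t, pairBlock_lt hs hlt h⟩
  constructor <;> intro j <;> dsimp only [oracleAdvice]
  · exact (Finset.sup_le fun t _ => hspan t).trans_lt ((span_le_allOnes s).trans_lt hall)
  · split_ifs
    exacts [(leftmostRight_le_allOnes j).trans_lt hall, by positivity]
  · split_ifs
    exacts [by positivity, (hcount _).trans_lt hlength]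
  · exact (hcard j _).trans_lt hlength
  · split_ifs
    exacts [by positivity, (Nat.le_of_add_right_le (hcount _)).trans_lt hlength]
  · exact (hcard j _).trans_lt hlength
  · exact fun hj => (rightmostLeft_eq_zero_iff hs).2 (hleft j hj)
  · exact fun hj => if_neg hj
  · intro h
    simp [(rightmostLeft_eq_zero_iff hs).1 h]
  · intro h
    have hempty : labelledIn s k p j Label.right = ∅ := by
      by_cases hj : 0 < j ∧ j < k
      · rw [if_pos hj, leftmostRight_eq_allOnes_iff hs] at h
        exact h.resolve_left (not_not.2 hj)
      · exact hright j hj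
    simp [hempty]

theorem mem_marked_iff (hs : IsLine s k) (hp : Monotone p) :
    t ∈ marked s k (oracleAdvice s k p) ↔ t < s.length ∧ pairLabel s k p t ≠ Label.inside := by
  have hmono : MonotoneOn (pairBlock s k p) (Set.Iio s.length) :=
    (pairBlock_mono hs hp).monotoneOn _
  have hR : markRight s k (oracleAdvice s k p) = (Finset.range s.length).filter fun t =>
      blockEnd s.length k (pairBlock s k p t) ≤ t ∧ pairBlock s k p t ≤ k - 1 :=
    foldl_markRight (blockEnd_mono _ _) hmono (fun t _ => one_le_pairBlock hs p t) fun j _ =>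
      congrArg Finset.card (labelledIn_right j)
  have hL : markLeft s k (oracleAdvice s k p) = (Finset.range s.length).filter fun t =>
      t < blockEnd s.length k (pairBlock s k p t - 1) ∧ 2 ≤ pairBlock s k p t := by
    have hk : k + 1 - (k - 1) = 2 := by have := hs.pos; omega
    have h := foldl_markLeft (n := s.length) (m := (oracleAdvice s k p).mL) (q := k - 1)
      (blockEnd_mono s.length k) hmono (blockEnd_self hs.pos).le (fun t _ => pairBlock_le hs p t)
      (Nat.sub_lt hs.pos one_pos) fun j _ => congrArg Finset.card (labelledIn_left j)
    rwa [hk] at h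
  rw [marked, hR, hL, Finset.mem_union, Finset.mem_filter, Finset.mem_filter, Finset.mem_range,
    ← pairLabel_eq_left, ← pairLabel_eq_right]
  constructor
  · rintro (⟨ht, h, -⟩ | ⟨ht, h, -⟩) <;> simp [ht, h]
  · rintro ⟨ht, h⟩
    cases hlabel : pairLabel s k p t
    · exact absurd hlabel h
    · exact Or.inr ⟨ht, rfl, one_lt_pairBlock hlabel⟩
    · exact Or.inl ⟨ht, rfl, Nat.le_pred_of_lt (pairBlock_lt hs ht hlabel)⟩

end SortedMatching

/-! ### The labels given by DIVIDE -/

/-- A served request without its server. -/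
def Served.request (e : Served) : ℝ × Label := (e.pos, e.label)

/-- The truncated positions of labelled requests, with their labels. -/
def truncList (s : List ℝ) (l : List (ℝ × Label)) : List (ℝ × Label) :=
  l.map fun e => (trunc s e.1, e.2)

/-- The requests `r` with the labels that DIVIDE gives to them.  The labels do not depend on the
servers used, so the log has the dummy server `0` throughout. -/
def labelledRequests (s : List ℝ) (k : ℕ) (a : DivideAdvice) (r : List ℝ) : List (ℝ × Label) :=
  r.foldl (fun l x => l ++ [(x, labelOf s k a (l.map fun e => ⟨e.1, e.2, 0⟩) x)]) []

section Labels

variable {s : List ℝ} {k : ℕ} {p : ℕ → ℕ} {u : ℕ}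

theorem labelOf_left_iff (hs : IsLine s k) (hp : Monotone p) {c : ℕ}
    (hc : c < ((pairList s k p).map Prod.fst).count (p u : ℝ)) :
    (1 < pairBlock s k p u ∧ (p u < (oracleAdvice s k p).qL (pairBlock s k p u) ∨
      (p u = (oracleAdvice s k p).qL (pairBlock s k p u) ∧
        (oracleAdvice s k p).dL (pairBlock s k p u) ≤ c))) ↔
    (pairList s k p).count ((p u : ℝ), Label.inside) +
      (pairList s k p).count ((p u : ℝ), Label.right) ≤ c := by
  have hblock {t : ℕ} (h : p t = p u) : pairBlock s k p t = pairBlock s k p u := by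
    rw [pairBlock, h, pairBlock]
  rw [count_map_fst] at hc
  dsimp only [oracleAdvice]
  by_cases hempty : labelledIn s k p (pairBlock s k p u) Label.left = ∅
  · have hleft : (pairList s k p).count ((p u : ℝ), Label.left) = 0 :=
      count_pairList_eq_zero fun t ht h hb =>
        Finset.notMem_empty t (hempty ▸ mem_labelledIn.2 ⟨ht, hblock h, hb⟩)
    rw [(rightmostLeft_eq_zero_iff hs).2 hempty]
    refine iff_of_false (fun h => ?_) (by omega)
    have hpos := pos_of_one_lt_pairBlock hs h.1
    omega
  rw [if_neg hempty]
  obtain ⟨t, ht⟩ := Finset.nonempty_iff_ne_empty.2 hempty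
  obtain ⟨-, hj, hlabel⟩ := mem_labelledIn.1 ht
  have hone : 1 < pairBlock s k p u := hj ▸ one_lt_pairBlock hlabel
  rcases lt_trichotomy (p u) (rightmostLeft s k p (pairBlock s k p u)) with hlt | heq | hgt
  · have hzero {b : Label} (hb : b ≠ Label.left) : (pairList s k p).count ((p u : ℝ), b) = 0 :=
      count_pairList_eq_zero fun t _ h hbt => hb (hbt.symm.trans
        (pairLabel_eq_left_of_lt_rightmostLeft hp (by rwa [h, hblock h])))
    simp [hone, hlt, hzero]
  · simp [hone, ← heq]
  · have hleft : (pairList s k p).count ((p u : ℝ), Label.left) = 0 :=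
      count_pairList_eq_zero fun t ht h hb =>
        (le_rightmostLeft (mem_labelledIn.2 ⟨ht, hblock h, hb⟩)).not_gt (h ▸ hgt)
    omega

theorem labelOf_right_iff (hs : IsLine s k) (hp : Monotone p) (hspan : ∀ t, p t ≤ span s) {c : ℕ}
    (hc : c < (pairList s k p).count ((p u : ℝ), Label.inside) +
      (pairList s k p).count ((p u : ℝ), Label.right)) :
    (pairBlock s k p u < k ∧ ((oracleAdvice s k p).qR (pairBlock s k p u) < p u ∨
      (p u = (oracleAdvice s k p).qR (pairBlock s k p u) ∧
        (oracleAdvice s k p).dR (pairBlock s k p u) ≤ c))) ↔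
    (pairList s k p).count ((p u : ℝ), Label.inside) ≤ c := by
  have hblock {t : ℕ} (h : p t = p u) : pairBlock s k p t = pairBlock s k p u := by
    rw [pairBlock, h, pairBlock]
  have hright_zero (h : ∀ t ∈ labelledIn s k p (pairBlock s k p u) Label.right, p t ≠ p u) :
      (pairList s k p).count ((p u : ℝ), Label.right) = 0 :=
    count_pairList_eq_zero fun t ht heq hb => h t (mem_labelledIn.2 ⟨ht, hblock heq, hb⟩) heq
  by_cases hempty : labelledIn s k p (pairBlock s k p u) Label.right = ∅
  · have hright := hright_zero fun t ht => absurd (hempty ▸ ht) (Finset.notMem_empty t)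
    refine iff_of_false (fun ⟨hk, h⟩ => ?_) (by omega)
    have hlt := (lt_span_of_pairBlock_lt hs hk).trans_le (span_le_allOnes s)
    dsimp only [oracleAdvice] at h
    rw [if_pos ⟨one_le_pairBlock hs p u, hk⟩, (leftmostRight_eq_allOnes_iff hs).2 hempty] at h
    omega
  obtain ⟨t, ht⟩ := Finset.nonempty_iff_ne_empty.2 hempty
  obtain ⟨hlt, hj, hlabel⟩ := mem_labelledIn.1 ht
  have hk : pairBlock s k p u < k := hj ▸ pairBlock_lt hs hlt hlabel
  dsimp only [oracleAdvice]
  rw [if_neg hempty, if_pos ⟨one_le_pairBlock hs p u, hk⟩]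
  rcases lt_trichotomy (leftmostRight s k p (pairBlock s k p u)) (p u) with hlt | heq | hgt
  · have hinside : (pairList s k p).count ((p u : ℝ), Label.inside) = 0 :=
      count_pairList_eq_zero fun t _ h hb => by
        rw [pairLabel_eq_right_of_leftmostRight_lt hp (hspan t) (by rwa [h, hblock h])] at hb
        cases hb
    simp [hk, hlt, hinside]
  · simp [hk, heq]
  · have hright := hright_zero fun t ht h => (leftmostRight_le ht).not_gt (h ▸ hgt)
    omega

theorem length_filter_inside (s : List ℝ) (log : List Served) (y : ℝ) :
    ((log.filter fun e => decide (trunc s e.pos = y)).filter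
      fun e => e.label = Label.inside).length =
      (truncList s (log.map Served.request)).count (y, Label.inside) := by
  rw [List.filter_filter, ← List.countP_eq_length_filter, truncList, List.map_map, List.count,
    List.countP_map]
  congr 1
  ext e
  change _ = ((trunc s e.pos, e.label) == (y, Label.inside))
  rw [← Bool.decide_and, beq_eq_decide]
  simp only [Prod.mk.injEq, and_comm]

theorem length_filter_ne_left (s : List ℝ) (log : List Served) (y : ℝ) :
    ((log.filter fun e => decide (trunc s e.pos = y)).filter
      fun e => e.label ≠ Label.left).length =
      (truncList s (log.map Served.request)).count (y, Label.inside) +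
        (truncList s (log.map Served.request)).count (y, Label.right) := by
  induction log with
  | nil => rfl
  | cons e l ih =>
    by_cases h1 : trunc s e.pos = y <;> cases h2 : e.label <;>
    simp [h1, h2, Served.request, truncList] at ih ⊢ <;> omega

theorem labelOf_congr {log log' : List Served} (a : DivideAdvice)
    (h : log.map Served.request = log'.map Served.request) (x : ℝ) :
    labelOf s k a log x = labelOf s k a log' x := by
  simp only [labelOf, length_filter_inside, length_filter_ne_left, h]

theorem labelOf_oracleAdvice (hs : IsLine s k) (hp : Monotone p) (hspan : ∀ t, p t ≤ span s)
    {log : List Served} {l : List (ℝ × Label)} (hl : truncList s (log.map Served.request) = l)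
    {x : ℝ} (hx : trunc s x = p u) (hlt : (l.map Prod.fst).count (p u : ℝ) <
      ((pairList s k p).map Prod.fst).count (p u : ℝ)) :
    labelOf s k (oracleAdvice s k p) log x =
      if (pairList s k p).count ((p u : ℝ), Label.inside) +
          (pairList s k p).count ((p u : ℝ), Label.right) ≤
        l.count ((p u : ℝ), Label.inside) + l.count ((p u : ℝ), Label.right) then Label.left
      else if (pairList s k p).count ((p u : ℝ), Label.inside) ≤ l.count ((p u : ℝ), Label.inside)
        then Label.right
      else Label.inside := by
  have hblock : blockOf s k x = pairBlock s k p u := by rw [pairBlock, ← hx, hs.blockOf_trunc]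
  simp only [labelOf, hblock, hx, length_filter_ne_left, length_filter_inside, hl, Nat.cast_lt,
    Nat.cast_inj]
  have htotal := count_map_fst l (p u)
  rw [if_congr (labelOf_left_iff hs hp (by omega)) rfl rfl]
  refine if_ctx_congr Iff.rfl (fun _ => rfl) fun hleft => ?_
  exact if_congr (labelOf_right_iff hs hp hspan (by omega)) rfl rfl

theorem labelledRequests_append (s : List ℝ) (k : ℕ) (a : DivideAdvice) (r : List ℝ) (x : ℝ) :
    labelledRequests s k a (r ++ [x]) = labelledRequests s k a r ++
      [(x, labelOf s k a ((labelledRequests s k a r).map fun e => ⟨e.1, e.2, 0⟩) x)] := by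
  rw [labelledRequests, List.foldl_append, List.foldl_cons, List.foldl_nil, ← labelledRequests]

theorem map_fst_labelledRequests (s : List ℝ) (k : ℕ) (a : DivideAdvice) (r : List ℝ) :
    (labelledRequests s k a r).map Prod.fst = r := by
  induction r using List.reverseRecOn with
  | nil => rfl
  | append_singleton r x ih => rw [labelledRequests_append, List.map_append, ih]; rfl

theorem map_fst_truncList (s : List ℝ) (k : ℕ) (a : DivideAdvice) (r : List ℝ) :
    (truncList s (labelledRequests s k a r)).map Prod.fst = r.map (trunc s) := by
  conv_rhs => rw [← map_fst_labelledRequests s k a r]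
  simp [truncList]

theorem truncList_append (s : List ℝ) (l : List (ℝ × Label)) (e : ℝ × Label) :
    truncList s (l ++ [e]) = truncList s l ++ [(trunc s e.1, e.2)] :=
  List.map_append

/-- The values of `p` at `0, ..., n - 1` are the truncated positions of the requests, in increasing
order. -/
structure IsSorting (s r : List ℝ) (p : ℕ → ℕ) : Prop where
  mono : Monotone p
  le_span : ∀ t, p t ≤ span s
  perm : (r.map (trunc s)).Perm ((List.range s.length).map fun t => (p t : ℝ))

variable {r q : List ℝ} {x : ℝ}

theorem IsSorting.labelOf_eq (hs : IsLine s k) (hp : IsSorting s r p) (hq : q ++ [x] <+: r) :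
    labelOf s k (oracleAdvice s k p)
      ((labelledRequests s k (oracleAdvice s k p) q).map fun e => ⟨e.1, e.2, 0⟩) x =
      if (pairList s k p).count (trunc s x, Label.inside) +
          (pairList s k p).count (trunc s x, Label.right) ≤
        (truncList s (labelledRequests s k (oracleAdvice s k p) q)).count
            (trunc s x, Label.inside) +
          (truncList s (labelledRequests s k (oracleAdvice s k p) q)).count
            (trunc s x, Label.right) then Label.left
      else if (pairList s k p).count (trunc s x, Label.inside) ≤
        (truncList s (labelledRequests s k (oracleAdvice s k p) q)).count
            (trunc s x, Label.inside) then Label.right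
      else Label.inside := by
  have hx : trunc s x ∈ r.map (trunc s) :=
    List.mem_map_of_mem (hq.subset (by simp))
  obtain ⟨u, -, hu⟩ := List.mem_map.1 (hp.perm.mem_iff.1 hx)
  rw [← hu]
  refine labelOf_oracleAdvice hs hp.mono hp.le_span (by simp [Function.comp_def, Served.request])
    hu.symm ?_
  rw [map_fst_truncList, map_fst_pairList, ← hp.perm.count_eq, hu]
  obtain ⟨l, rfl⟩ := hq
  simp

/-- Among the requests at a position, those that come first are left unmarked, the next ones are
marked right, and the last ones are marked left. -/
theorem IsSorting.count_labelledRequests (hs : IsLine s k) (hp : IsSorting s r p) (hq : q <+: r)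
    (y : ℝ) :
    (truncList s (labelledRequests s k (oracleAdvice s k p) q)).count (y, Label.inside) =
      min ((q.map (trunc s)).count y) ((pairList s k p).count (y, Label.inside)) ∧
    (truncList s (labelledRequests s k (oracleAdvice s k p) q)).count (y, Label.inside) +
        (truncList s (labelledRequests s k (oracleAdvice s k p) q)).count (y, Label.right) =
      min ((q.map (trunc s)).count y) ((pairList s k p).count (y, Label.inside) +
        (pairList s k p).count (y, Label.right)) := by
  induction q using List.reverseRecOn with
  | nil => simp [labelledRequests, truncList]
  | append_singleton q x ih =>
    obtain ⟨hinside, hboth⟩ := ih ((List.prefix_append q [x]).trans hq)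
    have hlabel := hp.labelOf_eq hs hq
    rw [labelledRequests_append, truncList_append, List.map_append]
    by_cases hxy : trunc s x = y
    · subst hxy
      split_ifs at hlabel <;> simp [hlabel] <;> omega
    · simpa [hxy] using ⟨hinside, hboth⟩

theorem IsSorting.pairwise_labelledRequests (hs : IsLine s k) (hp : IsSorting s r p)
    (hq : q <+: r) : (labelledRequests s k (oracleAdvice s k p) q).Pairwise fun e e' =>
      e.2 = Label.left → e'.2 = Label.right → trunc s e.1 ≠ trunc s e'.1 := by
  induction q using List.reverseRecOn with
  | nil => exact List.Pairwise.nil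
  | append_singleton q x ih =>
    have hq' := (List.prefix_append q [x]).trans hq
    rw [labelledRequests_append, List.pairwise_append]
    refine ⟨ih hq', List.pairwise_singleton _ _, fun e he e' he' hleft hright heq => ?_⟩
    obtain rfl := List.mem_singleton.1 he'
    have hmem : (trunc s x, Label.left) ∈
        truncList s (labelledRequests s k (oracleAdvice s k p) q) :=
      List.mem_map.2 ⟨e, he, by rw [hleft, heq]⟩
    have hpos := List.count_pos_iff.2 hmem
    have hboth := (hp.count_labelledRequests hs hq' (trunc s x)).2
    have htotal := count_map_fst (truncList s (labelledRequests s k (oracleAdvice s k p) q))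
      (trunc s x)
    rw [map_fst_truncList] at htotal
    simp only [hp.labelOf_eq hs hq] at hright
    split_ifs at hright
    omega

theorem IsSorting.truncList_perm (hs : IsLine s k) (hp : IsSorting s r p) :
    (truncList s (labelledRequests s k (oracleAdvice s k p) r)).Perm (pairList s k p) := by
  rw [List.perm_iff_count]
  rintro ⟨y, b⟩
  obtain ⟨hinside, hboth⟩ := hp.count_labelledRequests hs List.prefix_rfl y
  have hpair := count_map_fst (pairList s k p) y
  have htrunc := count_map_fst (truncList s (labelledRequests s k (oracleAdvice s k p) r)) y
  rw [map_fst_pairList, ← hp.perm.count_eq] at hpair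
  rw [map_fst_truncList] at htrunc
  cases b <;> omega

/-- A log that serves the requests according to an optimal matching that agrees with the labels
given by DIVIDE. -/
structure IsOptimalLog (s : List ℝ) (k : ℕ) (p : ℕ → ℕ) (r : List ℝ) (Z : List Served) : Prop where
  request : Z.map Served.request = labelledRequests s k (oracleAdvice s k p) r
  perm : (Z.map Served.server).Perm (List.range s.length)
  trunc_pos : ∀ e ∈ Z, trunc s e.pos = p e.server
  pairLabel_server : ∀ e ∈ Z, pairLabel s k p e.server = e.label

theorem IsSorting.exists_isOptimalLog (hs : IsLine s k) (hp : IsSorting s r p) :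
    ∃ Z, IsOptimalLog s k p r Z := by
  obtain ⟨σ, hσ, hmap⟩ := exists_perm_map_eq (hp.truncList_perm hs)
  set l := labelledRequests s k (oracleAdvice s k p) r
  have hlength : l.length = σ.length := by simpa [truncList] using (congrArg List.length hmap).symm
  have hzip : ∀ e ∈ l.zip σ, (trunc s e.1.1, e.1.2) = ((p e.2 : ℝ), pairLabel s k p e.2) := by
    intro e he
    obtain ⟨i, hi, rfl⟩ := List.getElem_of_mem he
    have hget := List.getElem_of_eq hmap (i := i) (by simp at hi ⊢; omega)
    simpa [truncList] using hget.symm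
  refine ⟨(l.zip σ).map fun e => ⟨e.1.1, e.1.2, e.2⟩, ?_, ?_, ?_, ?_⟩
  · simpa [Function.comp_def, Served.request] using List.map_fst_zip hlength.le
  · simpa [Function.comp_def, List.map_snd_zip hlength.ge] using hσ
  all_goals
    simp only [List.mem_map]
    rintro _ ⟨e, he, rfl⟩
  · exact congrArg Prod.fst (hzip e he)
  · exact (congrArg Prod.snd (hzip e he)).symm

end Labels

/-! ### The run of DIVIDE -/

/-- The requests `r` served by DIVIDE with advice `a`, with their labels and servers. -/
def divideLog (A : OnlineAlg) (s : List ℝ) (k : ℕ) (a : DivideAdvice) (r : List ℝ) :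
    List Served :=
  r.foldl (fun log x => log ++ [⟨x, labelOf s k a log x, divideServe A s k a log x⟩]) []

section Run

variable (k : ℕ) (A : OnlineAlg) (s : List ℝ) (a : DivideAdvice) (r : List ℝ)

theorem divideLog_append (x : ℝ) : divideLog A s k a (r ++ [x]) = divideLog A s k a r ++
    [⟨x, labelOf s k a (divideLog A s k a r) x, divideServe A s k a (divideLog A s k a r) x⟩] := by
  rw [divideLog, List.foldl_append, List.foldl_cons, List.foldl_nil, ← divideLog]

theorem serveFrom_divide_cons (st : DivideState) (x : ℝ) :
    (divide k A).serveFrom st (x :: r) =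
      (divide k A).serveFrom ({ st with log := st.log ++ [⟨x,
        labelOf st.servers k st.advice st.log x,
        divideServe A st.servers k st.advice st.log x⟩] } : DivideState) r >>= fun σ =>
          pure (divideServe A st.servers k st.advice st.log x :: σ) :=
  rfl

theorem map_server_append_eval_serveFrom_divide (log : List Served) (t : ℕ → Bool) :
    log.map Served.server ++ ((divide k A).serveFrom (⟨s, a, log⟩ : DivideState) r).eval t =
      (r.foldl (fun log x => log ++ [⟨x, labelOf s k a log x, divideServe A s k a log x⟩])
        log).map Served.server := by
  induction r generalizing log with
  | nil => exact List.append_nil _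
  | cons x r ih =>
    rw [List.foldl_cons, ← ih, List.map_append, List.append_assoc, serveFrom_divide_cons, eval_bind]
    rfl

theorem eval_run_divide (t : ℕ → Bool) : ((divide k A).run s r).eval t =
    (divideLog A s k ((readAdvice s k).eval t) r).map Served.server := by
  rw [AdviceAlg.run, eval_bind, divideLog, ← map_server_append_eval_serveFrom_divide,
    List.map_nil, List.nil_append]
  congr 2
  exact eval_bind _ _ t

theorem bits_serveFrom_divide (st : DivideState) (t : ℕ → Bool) :
    ((divide k A).serveFrom st r).bits t = 0 := by
  induction r generalizing st t with
  | nil => rfl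
  | cons x r ih =>
    rw [serveFrom_divide_cons, bits_bind, ih]
    rfl

theorem bits_run_divide (t : ℕ → Bool) :
    ((divide k A).run s r).bits t = (readAdvice s k).bits t := by
  rw [AdviceAlg.run, bits_bind]
  exact congrArg₂ (· + ·) (bits_bind _ _ t) (bits_serveFrom_divide k A r _ _)

theorem map_request_divideLog :
    (divideLog A s k a r).map Served.request = labelledRequests s k a r := by
  induction r using List.reverseRecOn with
  | nil => rfl
  | append_singleton r x ih =>
    rw [divideLog_append, labelledRequests_append, List.map_append, ih,
      labelOf_congr a (log' := (labelledRequests s k a r).map fun e => ⟨e.1, e.2, 0⟩) _ x]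
    · rfl
    · simpa [Function.comp_def, Served.request] using ih

theorem runServe_append (serve : List ℝ → List ℝ → ℝ → ℕ) (x : ℝ) :
    runServe serve s (r ++ [x]) = runServe serve s r ++ [serve s r x] := by
  simp only [runServe, List.mapIdx_append, List.mapIdx_singleton, zero_add, List.take_left]
  congr 1
  exact List.ext_getElem (by simp) fun i hi _ => by
    rw [List.length_mapIdx] at hi
    simp [List.take_append_of_le_length hi.le]

end Run

/-! ### The parts of a log -/

/-- The unmarked requests of block `j`. -/
def insideList (s : List ℝ) (k j : ℕ) (l : List Served) : List Served :=
  l.filter fun e => decide (e.label = Label.inside ∧ blockOf s k e.pos = j)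

/-- The marked requests. -/
def markedList (l : List Served) : List Served :=
  l.filter fun e => decide (¬ e.label = Label.inside)

/-- The total distance between the requests and their servers. -/
def logCost (s : List ℝ) (l : List Served) : ℝ :=
  (l.map fun e => |e.pos - s.getD e.server 0|).sum

/-- The request as LR sees it: its position, and the bit that LR gets for it. -/
def Served.directed (e : Served) : ℝ × Bool := (e.pos, decide (e.label = Label.right))

/-- The unmarked servers of block `j`. -/
def insideServers (s : List ℝ) (k : ℕ) (a : DivideAdvice) (j : ℕ) : List ℕ :=
  (List.range s.length).filter fun i =>
    decide (blockEnd s.length k (j - 1) ≤ i ∧ i < blockEnd s.length k j ∧ i ∉ marked s k a)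

/-- The positions of the unmarked servers of block `j`. -/
def insidePositions (s : List ℝ) (k : ℕ) (a : DivideAdvice) (j : ℕ) : List ℝ :=
  (insideServers s k a j).map fun i => s.getD i 0

section Parts

variable {s : List ℝ} {k : ℕ} {l l' : List Served}

theorem logCost_eq_sum (hk : 0 < k) : logCost s l =
    ∑ j ∈ Finset.Icc 1 k, logCost s (insideList s k j l) + logCost s (markedList l) :=
  sum_map_eq_sum_blocks l _ _ (fun e => blockOf s k e.pos) k fun _ _ =>
    Finset.mem_Icc.2 ⟨one_le_blockOf hk _, blockOf_le hk _⟩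

theorem logCost_eq_cost :
    logCost s l = cost s (l.map Served.pos) (l.map Served.server) := by
  rw [logCost, cost, List.zipWith_map, List.zipWith_self]

theorem map_pos_eq_of_map_request_eq (h : l.map Served.request = l'.map Served.request) :
    l.map Served.pos = l'.map Served.pos := by
  simpa [Function.comp_def, Served.request] using congrArg (List.map Prod.fst) h

theorem map_pos_insideList_congr (h : l.map Served.request = l'.map Served.request) (j : ℕ) :
    (insideList s k j l).map Served.pos = (insideList s k j l').map Served.pos := by
  have hfilter (l : List Served) : (insideList s k j l).map Served.pos =
      ((l.map Served.request).filter fun e =>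
        decide (e.2 = Label.inside ∧ blockOf s k e.1 = j)).map Prod.fst := by
    rw [List.filter_map, List.map_map]
    rfl
  rw [hfilter, h, ← hfilter]

theorem map_directed_markedList_congr (h : l.map Served.request = l'.map Served.request) :
    (markedList l).map Served.directed = (markedList l').map Served.directed := by
  have hfilter (l : List Served) : (markedList l).map Served.directed =
      ((l.map Served.request).filter fun e => decide (¬ e.2 = Label.inside)).map fun e =>
        (e.1, decide (e.2 = Label.right)) := by
    rw [List.filter_map, List.map_map]
    rfl
  rw [hfilter, h, ← hfilter]

end Parts

section Divide

variable (A : OnlineAlg) (s : List ℝ) (k : ℕ) (a : DivideAdvice) (r : List ℝ)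

theorem map_server_insideList_divideLog (j : ℕ) :
    (insideList s k j (divideLog A s k a r)).map Served.server =
      (A.run (insidePositions s k a j)
        ((insideList s k j (divideLog A s k a r)).map Served.pos)).map
          fun i => (insideServers s k a j).getD i 0 := by
  induction r using List.reverseRecOn with
  | nil => rfl
  | append_singleton r x ih =>
    rw [insideList, divideLog_append, List.filter_append, ← insideList, List.map_append,
      List.map_append, ih]
    by_cases hx : labelOf s k a (divideLog A s k a r) x = Label.inside ∧ blockOf s k x = j
    · obtain ⟨hlabel, rfl⟩ := hx
      simp only [hlabel, List.filter_singleton, and_self, decide_true, cond_true,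
        List.map_singleton, OnlineAlg.run, runServe_append, List.map_append]
      congr 2
      simp only [divideServe, hlabel, serveInside]
      rfl
    · simp [hx]

variable {A s k a}

theorem marked_sdiff_map_server {l : List Served}
    (hl : ∀ e ∈ l, e.label = Label.inside → e.server ∉ marked s k a) :
    marked s k a \ (l.map Served.server).toFinset =
      marked s k a \ ((markedList l).map Served.server).toFinset := by
  ext i
  simp only [markedList, Finset.mem_sdiff, List.mem_toFinset, List.mem_map, List.mem_filter,
    decide_eq_true_eq, not_exists, not_and]
  refine and_congr_right fun hi => ⟨fun h e he => h e he.1, fun h e he hei => ?_⟩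
  exact h e ⟨he, fun hin => hl e he hin (hei ▸ hi)⟩ hei

theorem divideServe_marked {log : List Served} {x : ℝ}
    (hx : labelOf s k a log x ≠ Label.inside) : divideServe A s k a log x =
      serveMarked s k a log (decide (labelOf s k a log x = Label.right)) x := by
  cases h : labelOf s k a log x <;> simp_all [divideServe]

theorem map_server_markedList_divideLog {r : List ℝ}
    (hr : ∀ e ∈ divideLog A s k a r, e.label = Label.inside → e.server ∉ marked s k a) :
    (markedList (divideLog A s k a r)).map Served.server =
      lrRun s (marked s k a) ((markedList (divideLog A s k a r)).map Served.directed) := by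
  induction r using List.reverseRecOn with
  | nil => rfl
  | append_singleton r x ih =>
    rw [divideLog_append] at hr
    have hr' := fun e he => hr e (List.mem_append_left _ he)
    rw [markedList, divideLog_append, List.filter_append, ← markedList, List.map_append,
      List.map_append, ih hr']
    by_cases hx : labelOf s k a (divideLog A s k a r) x = Label.inside
    · simp [hx]
    · simp only [hx, List.filter_singleton, not_false_eq_true, decide_true, cond_true,
        List.map_singleton, lrRun_append, ← ih hr', divideServe_marked hx, serveMarked,
        marked_sdiff_map_server hr']
      rfl

end Divide

/-! ### Costs of matchings -/

section Cost

variable {s r : List ℝ} {σ : List ℕ}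

theorem cost_nonneg (s r : List ℝ) (σ : List ℕ) : 0 ≤ cost s r σ := by
  refine List.sum_nonneg fun x hx => ?_
  obtain ⟨i, hi, rfl⟩ := List.getElem_of_mem hx
  rw [List.getElem_zipWith]
  exact abs_nonneg _

theorem opt_le_cost (hσ : IsMatching s.length σ) : opt s r ≤ cost s r σ :=
  csInf_le ⟨0, by rintro x ⟨σ, -, rfl⟩; exact cost_nonneg s r σ⟩ ⟨σ, hσ, rfl⟩

theorem le_opt {x : ℝ} (h : ∀ σ, IsMatching s.length σ → x ≤ cost s r σ) : x ≤ opt s r :=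
  le_csInf ⟨_, List.range s.length, List.Perm.refl _, rfl⟩ (by rintro _ ⟨σ, hσ, rfl⟩; exact h σ hσ)

theorem opt_nonneg (s r : List ℝ) : 0 ≤ opt s r :=
  le_opt fun σ _ => cost_nonneg s r σ

theorem cost_cons_cons (s : List ℝ) (x : ℝ) (r : List ℝ) (j : ℕ) (σ : List ℕ) :
    cost s (x :: r) (j :: σ) = |x - s.getD j 0| + cost s r σ := by
  rw [cost, List.zipWith_cons_cons, List.sum_cons, cost]

theorem cost_map_getD {V : List ℕ} (hσ : ∀ i ∈ σ, i < V.length) (s r : List ℝ) :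
    cost (V.map fun i => s.getD i 0) r σ = cost s r (σ.map fun i => V.getD i 0) := by
  rw [cost, cost, List.zipWith_map_right]
  exact congrArg List.sum (List.ext_getElem (by simp) fun i _ _ => by simp [hσ])

theorem opt_map_le {V : List ℕ} (hV : V.Nodup) (hσ : σ.Perm V) (s r : List ℝ) :
    opt (V.map fun i => s.getD i 0) r ≤ cost s r σ := by
  have hidx : (V.map fun i => V.idxOf i) = List.range V.length :=
    List.ext_getElem (by simp) fun i _ _ => by simp [hV.idxOf_getElem]
  have hmatching : IsMatching V.length (σ.map fun i => V.idxOf i) := by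
    rw [IsMatching, ← hidx]
    exact hσ.map _
  have hgetD : (σ.map fun i => V.idxOf i).map (fun i => V.getD i 0) = σ := by
    rw [List.map_map, List.map_congr_left (g := id), List.map_id]
    exact fun i hi => by simp [List.idxOf_lt_length_of_mem (hσ.mem_iff.1 hi)]
  refine (opt_le_cost (by rwa [List.length_map])).trans_eq ?_
  rw [cost_map_getD fun i hi => List.mem_range.1 (hmatching.mem_iff.1 hi), hgetD]

theorem cost_range_le_cost (hs : s.Pairwise (· ≤ ·)) {x y : List ℝ} (hx : x.Pairwise (· ≤ ·))
    (hxy : x.Perm y) (hlength : y.length = s.length) (hσ : IsMatching s.length σ) :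
    cost s x (List.range s.length) ≤ cost s y σ := by
  have hrange : (List.range s.length).map (fun i => s.getD i 0) = s :=
    List.ext_getElem (by simp) fun i _ hi => by simp [hi]
  have hlengthσ : y.length = σ.length := by simpa [hlength] using hσ.length_eq.symm
  set l := y.zip (σ.map fun i => s.getD i 0)
  have hfst : l.map Prod.fst = y := List.map_fst_zip (by simp [hlengthσ])
  have hsnd : l.map Prod.snd = σ.map fun i => s.getD i 0 := List.map_snd_zip (by simp [hlengthσ])
  have hcost : cost s y σ = (l.map fun e => |e.1 - e.2|).sum := by
    rw [cost, List.map_zip_eq_zipWith, List.zipWith_map_right]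
    rfl
  obtain ⟨l', hl', rfl⟩ := exists_perm_map_eq (hfst ▸ hxy)
  have hperm : (l'.map Prod.snd).Perm s :=
    ((hl'.map _).trans (.of_eq hsnd)).trans ((hσ.map _).trans (.of_eq hrange))
  rw [hcost, ← (hl'.map _).sum_eq, cost, ← List.zipWith_map_right (f := fun i => s.getD i 0)
    (g := fun x a => |x - a|), hrange]
  exact sum_abs_sub_sorted_le hx hs hperm

end Cost

section Line

variable {s r : List ℝ} {k : ℕ} {p : ℕ → ℕ}

theorem IsLine.abs_sub_eq (hs : IsLine s k) (x : ℝ) {j : ℕ} (hj : j < s.length) :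
    |x - s.getD j 0| = |x - trunc s x| + |trunc s x - s.getD j 0| := by
  have hone := hs.one_le j hj
  have hspan := hs.le_span j hj
  unfold trunc
  rcases le_total (span s : ℝ) x with hx | hx
  · rw [min_eq_left hx, max_eq_right (by linarith), abs_of_nonneg, abs_of_nonneg, abs_of_nonneg] <;>
    linarith
  · rw [min_eq_right hx]
    rcases le_total 0 x with h0 | h0
    · simp [max_eq_right h0]
    · rw [max_eq_left h0, abs_of_nonpos, abs_of_nonpos, abs_of_nonpos] <;> linarith

theorem IsLine.cost_eq (hs : IsLine s k) {σ : List ℕ} (hlength : r.length = σ.length)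
    (hσ : ∀ j ∈ σ, j < s.length) :
    cost s r σ = (r.map fun x => |x - trunc s x|).sum + cost s (r.map (trunc s)) σ := by
  induction r generalizing σ with
  | nil => simp [cost]
  | cons x r ih =>
    obtain ⟨j, σ, rfl⟩ := List.exists_cons_of_length_eq_add_one hlength.symm
    rw [cost_cons_cons, hs.abs_sub_eq x (hσ j List.mem_cons_self),
      ih (Nat.succ.inj hlength) fun i hi => hσ i (List.mem_cons_of_mem j hi), List.map_cons,
      List.sum_cons, List.map_cons, cost_cons_cons]
    ring

namespace IsOptimalLog

variable {Z : List Served}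

theorem map_pos (hZ : IsOptimalLog s k p r Z) : Z.map Served.pos = r := by
  rw [← map_fst_labelledRequests s k (oracleAdvice s k p) r, ← hZ.request, List.map_map]
  rfl

theorem cost_trunc (hZ : IsOptimalLog s k p r Z) :
    cost s (r.map (trunc s)) (Z.map Served.server) =
      cost s ((List.range s.length).map fun t => (p t : ℝ)) (List.range s.length) := by
  rw [← hZ.map_pos, List.map_map, cost, cost, List.zipWith_map, List.zipWith_self,
    List.zipWith_map_left, List.zipWith_self, ← (hZ.perm.map _).sum_eq, List.map_map]
  exact congrArg List.sum (List.map_congr_left fun e he => by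
    simp only [Function.comp_apply, hZ.trunc_pos e he])

theorem logCost_eq_opt (hs : IsLine s k) (hp : IsSorting s r p) (hZ : IsOptimalLog s k p r Z) :
    logCost s Z = opt s r := by
  have hlength : r.length = s.length := by simpa using hp.perm.length_eq
  rw [logCost_eq_cost, hZ.map_pos]
  refine le_antisymm (le_opt fun σ hσ => ?_) (opt_le_cost hZ.perm)
  have hlt {σ : List ℕ} (hσ : IsMatching s.length σ) : ∀ j ∈ σ, j < s.length :=
    fun j hj => List.mem_range.1 (hσ.mem_iff.1 hj)
  have hlengthσ {σ : List ℕ} (hσ : IsMatching s.length σ) : r.length = σ.length := by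
    simpa [hlength] using hσ.length_eq.symm
  rw [hs.cost_eq (hlengthσ hZ.perm) (hlt hZ.perm), hs.cost_eq (hlengthσ hσ) (hlt hσ),
    hZ.cost_trunc]
  gcongr
  refine cost_range_le_cost hs.sorted ?_ hp.perm.symm (by simp [hlength]) hσ
  exact List.pairwise_map.2 (List.pairwise_le_range.imp fun hij => by exact_mod_cast hp.mono hij)

end IsOptimalLog

end Line

/-! ### The matching of DIVIDE -/

theorem blockEnd_unique {n k i j t : ℕ}
    (hi : blockEnd n k (i - 1) ≤ t ∧ t < blockEnd n k i)
    (hj : blockEnd n k (j - 1) ≤ t ∧ t < blockEnd n k j) : i = j := by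
  rcases lt_trichotomy i j with h | h | h
  · have := blockEnd_mono n k (Nat.le_sub_one_of_lt h)
    omega
  · exact h
  · have := blockEnd_mono n k (Nat.le_sub_one_of_lt h)
    omega

theorem trunc_lt_trunc {s : List ℝ} {x y : ℝ} (h : x < y) (hx : x < span s) (hy : 0 < y) :
    trunc s x < trunc s y := by
  have hspan : (0 : ℝ) < span s := Nat.cast_pos.2 (Nat.succ_pos _)
  unfold trunc
  rw [min_eq_right hx.le]
  exact max_lt (lt_max_of_lt_right (lt_min hspan hy)) (lt_max_of_lt_right (lt_min hx h))

theorem map_server_perm_of_parts {s : List ℝ} {k : ℕ} {l l' : List Served} (hk : 0 < k)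
    (hinside : ∀ j, ((insideList s k j l).map Served.server).Perm
      ((insideList s k j l').map Served.server))
    (hmarked : ((markedList l).map Served.server).Perm ((markedList l').map Served.server)) :
    (l.map Served.server).Perm (l'.map Served.server) := by
  have hsum (l : List Served) : ((l.map Served.server : List ℕ) : Multiset ℕ) =
      (l.map fun e => ({e.server} : Multiset ℕ)).sum := by
    rw [← Multiset.sum_map_singleton ((l.map Served.server : List ℕ) : Multiset ℕ)]
    simp [Function.comp_def]
  have hparts (l : List Served) : ((l.map Served.server : List ℕ) : Multiset ℕ) =
      ∑ j ∈ Finset.Icc 1 k, (((insideList s k j l).map Served.server : List ℕ) : Multiset ℕ) +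
        (((markedList l).map Served.server : List ℕ) : Multiset ℕ) := by
    simp only [hsum]
    exact sum_map_eq_sum_blocks l _ _ (fun e => blockOf s k e.pos) k fun _ _ =>
      Finset.mem_Icc.2 ⟨one_le_blockOf hk _, blockOf_le hk _⟩
  rw [← Multiset.coe_eq_coe, hparts l, hparts l', Multiset.coe_eq_coe.2 hmarked]
  exact congrArg (· + _) (Finset.sum_congr rfl fun j _ => Multiset.coe_eq_coe.2 (hinside j))

namespace IsOptimalLog

variable {s r : List ℝ} {k : ℕ} {p : ℕ → ℕ} {Z : List Served} {e e' : Served}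

theorem server_lt (hZ : IsOptimalLog s k p r Z) (he : e ∈ Z) : e.server < s.length :=
  List.mem_range.1 (hZ.perm.mem_iff.1 (List.mem_map_of_mem he))

theorem exists_server_eq (hZ : IsOptimalLog s k p r Z) {t : ℕ} (ht : t < s.length) :
    ∃ e ∈ Z, e.server = t :=
  List.mem_map.1 (hZ.perm.mem_iff.2 (List.mem_range.2 ht))

theorem pairBlock_server (hs : IsLine s k) (hZ : IsOptimalLog s k p r Z) (he : e ∈ Z) :
    pairBlock s k p e.server = blockOf s k e.pos := by
  rw [pairBlock, ← hZ.trunc_pos e he, hs.blockOf_trunc]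

theorem map_server_insideList_perm (hs : IsLine s k) (hp : Monotone p)
    (hZ : IsOptimalLog s k p r Z) (j : ℕ) :
    ((insideList s k j Z).map Served.server).Perm (insideServers s k (oracleAdvice s k p) j) := by
  rw [insideList, insideServers, List.perm_ext_iff_of_nodup
    ((hZ.perm.nodup_iff.2 List.nodup_range).sublist (List.filter_sublist.map _))
    (List.nodup_range.filter _)]
  intro t
  simp only [List.mem_map, List.mem_filter, List.mem_range, decide_eq_true_eq,
    mem_marked_iff hs hp]
  constructor
  · rintro ⟨e, ⟨he, hinside, rfl⟩, rfl⟩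
    have hlabel := (hZ.pairLabel_server e he).trans hinside
    rw [← hZ.pairBlock_server hs he]
    have hblock := pairLabel_eq_inside.1 hlabel
    exact ⟨hZ.server_lt he, hblock.1, hblock.2, fun h => h.2 hlabel⟩
  · rintro ⟨hlt, hle, hend, hmarked⟩
    obtain ⟨e, he, rfl⟩ := hZ.exists_server_eq hlt
    have hlabel : pairLabel s k p e.server = Label.inside := by tauto
    refine ⟨e, ⟨he, (hZ.pairLabel_server e he).symm.trans hlabel, ?_⟩, rfl⟩
    rw [← hZ.pairBlock_server hs he]
    exact blockEnd_unique (pairLabel_eq_inside.1 hlabel) ⟨hle, hend⟩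

theorem toFinset_map_server_markedList (hs : IsLine s k) (hp : Monotone p)
    (hZ : IsOptimalLog s k p r Z) :
    ((markedList Z).map Served.server).toFinset = marked s k (oracleAdvice s k p) := by
  ext t
  simp only [markedList, List.mem_toFinset, List.mem_map, List.mem_filter, decide_eq_true_eq,
    mem_marked_iff hs hp]
  constructor
  · rintro ⟨e, ⟨he, hlabel⟩, rfl⟩
    exact ⟨hZ.server_lt he, by rwa [hZ.pairLabel_server e he]⟩
  · rintro ⟨hlt, hlabel⟩
    obtain ⟨e, he, rfl⟩ := hZ.exists_server_eq hlt
    exact ⟨e, ⟨he, by rwa [← hZ.pairLabel_server e he]⟩, rfl⟩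

theorem exists_border_of_left (hs : IsLine s k) (hZ : IsOptimalLog s k p r Z) (he : e ∈ Z)
    (hleft : e.label = Label.left) :
    ∃ i, 0 < i ∧ i < k ∧ s.getD e.server 0 ≤ border s k i ∧ border s k i < e.pos := by
  have hlabel := (hZ.pairLabel_server e he).trans hleft
  have hone := one_lt_pairBlock hlabel
  have hle := pairBlock_le hs p e.server
  have hserver := pairLabel_eq_left.1 hlabel
  rw [hZ.pairBlock_server hs he] at hone hle hserver
  exact ⟨blockOf s k e.pos - 1, by omega, by omega, hs.le_border (by omega) hserver,
    border_lt_of_one_lt_blockOf hs.pos hone⟩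

theorem exists_border_of_right (hs : IsLine s k) (hZ : IsOptimalLog s k p r Z) (he : e ∈ Z)
    (hright : e.label = Label.right) :
    ∃ i < k, e.pos ≤ border s k i ∧ border s k i ≤ s.getD e.server 0 := by
  have hlabel := (hZ.pairLabel_server e he).trans hright
  have hlt := pairBlock_lt hs (hZ.server_lt he) hlabel
  have hserver := pairLabel_eq_right.1 hlabel
  rw [hZ.pairBlock_server hs he] at hlt hserver
  exact ⟨_, hlt, le_border_of_blockOf_lt hlt, hs.border_le hserver (hZ.server_lt he)⟩

theorem getD_server_le_of_right_of_left (hs : IsLine s k) (hp : Monotone p)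
    (hZ : IsOptimalLog s k p r Z) (he : e ∈ Z) (he' : e' ∈ Z) (hright : e.label = Label.right)
    (hleft : e'.label = Label.left) (hlt : e.pos < e'.pos) :
    s.getD e.server 0 ≤ s.getD e'.server 0 := by
  obtain ⟨i, hik, hpos, -⟩ := hZ.exists_border_of_right hs he hright
  obtain ⟨i', hi', hik', -, hpos'⟩ := hZ.exists_border_of_left hs he' hleft
  have hspan : e.pos < span s := (hpos.trans (hs.border_le_span hik)).trans_lt (sub_one_lt _)
  have hzero : 0 < e'.pos := (zero_lt_one.trans_le (hs.one_le_border hi' hik')).trans hpos'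
  have htrunc := trunc_lt_trunc hlt hspan hzero
  rw [hZ.trunc_pos e he, hZ.trunc_pos e' he', Nat.cast_lt] at htrunc
  exact getD_le_getD hs.sorted (hp.reflect_lt htrunc).le (hZ.server_lt he')

theorem isDirected_markedList (hs : IsLine s k) (hp : IsSorting s r p)
    (hZ : IsOptimalLog s k p r Z) :
    IsDirected (((markedList Z).map fun e => (e.directed, e.server)).map (locate s)) := by
  have hright {e : Served} (h : e.directed.2 = true) : e.label = Label.right := of_decide_eq_true h
  have hleft {e : Served} (hmarked : e.label ≠ Label.inside) (h : e.directed.2 = false) :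
      e.label = Label.left := by
    have hne : e.label ≠ Label.right := of_decide_eq_false h
    cases hlabel : e.label <;> simp_all
  have hmem {x : (ℝ × Bool) × ℝ}
      (hx : x ∈ ((markedList Z).map fun e => (e.directed, e.server)).map (locate s)) :
      ∃ e ∈ Z, e.label ≠ Label.inside ∧ (e.directed, s.getD e.server 0) = x := by
    rw [List.map_map, List.mem_map] at hx
    obtain ⟨e, he, rfl⟩ := hx
    obtain ⟨he, hmarked⟩ := List.mem_filter.1 he
    exact ⟨e, he, of_decide_eq_true hmarked, rfl⟩
  constructor
  · rintro x hx hbit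
    obtain ⟨e, he, hmarked, rfl⟩ := hmem hx
    obtain ⟨i, -, -, hserver, hpos⟩ := hZ.exists_border_of_left hs he (hleft hmarked hbit)
    exact hserver.trans_lt hpos
  · rintro x hx hbit
    obtain ⟨e, he, -, rfl⟩ := hmem hx
    obtain ⟨i, -, hpos, hserver⟩ := hZ.exists_border_of_right hs he (hright hbit)
    exact hpos.trans hserver
  · rintro x hx x' hx' hbit hbit' hlt
    obtain ⟨e, he, -, rfl⟩ := hmem hx
    obtain ⟨e', he', hmarked, rfl⟩ := hmem hx'
    exact hZ.getD_server_le_of_right_of_left hs hp.mono he he' (hright hbit)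
      (hleft hmarked hbit') hlt
  · have hpairwise := hp.pairwise_labelledRequests hs List.prefix_rfl
    rw [← hZ.request, List.pairwise_map] at hpairwise
    rw [List.map_map, List.map_map, List.pairwise_map]
    refine (hpairwise.filter _).imp_of_mem fun he _ h hbit hbit' hpos => ?_
    exact h (hleft (of_decide_eq_true (List.mem_filter.1 he).2) hbit) (hright hbit')
      (congrArg (trunc s) hpos)

theorem isInput_insidePositions (hs : IsLine s k) (hp : Monotone p) (hZ : IsOptimalLog s k p r Z)
    (j : ℕ) : IsInput (insidePositions s k (oracleAdvice s k p) j)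
      ((insideList s k j Z).map Served.pos) := by
  constructor
  · rw [insidePositions, List.pairwise_map]
    refine (List.pairwise_lt_range.sublist List.filter_sublist).imp_of_mem fun _ hi' hlt => ?_
    exact getD_le_getD hs.sorted hlt.le (List.mem_range.1 (List.mem_filter.1 hi').1)
  · simpa [insidePositions] using (hZ.map_server_insideList_perm hs hp j).length_eq

section Divide

variable (A : OnlineAlg)

theorem map_request_divideLog (hZ : IsOptimalLog s k p r Z) :
    (divideLog A s k (oracleAdvice s k p) r).map Served.request = Z.map Served.request :=
  (LineMatching.map_request_divideLog k A s _ r).trans hZ.request.symm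

theorem run_insidePositions_perm (hs : IsLine s k) (hp : Monotone p)
    (hZ : IsOptimalLog s k p r Z) (j : ℕ) :
    (A.run (insidePositions s k (oracleAdvice s k p) j) ((insideList s k j Z).map Served.pos)).Perm
      (List.range (insideServers s k (oracleAdvice s k p) j).length) := by
  have hlegal := A.legal _ _ (hZ.isInput_insidePositions hs hp j)
  rwa [IsMatching, insidePositions, List.length_map] at hlegal

theorem map_server_insideList_divideLog (hZ : IsOptimalLog s k p r Z) (j : ℕ) :
    (insideList s k j (divideLog A s k (oracleAdvice s k p) r)).map Served.server =
      (A.run (insidePositions s k (oracleAdvice s k p) j)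
        ((insideList s k j Z).map Served.pos)).map
          fun i => (insideServers s k (oracleAdvice s k p) j).getD i 0 := by
  rw [LineMatching.map_server_insideList_divideLog,
    map_pos_insideList_congr (hZ.map_request_divideLog A)]

theorem logCost_insideList_divideLog (hs : IsLine s k) (hp : Monotone p)
    (hZ : IsOptimalLog s k p r Z) (j : ℕ) :
    logCost s (insideList s k j (divideLog A s k (oracleAdvice s k p) r)) =
      cost (insidePositions s k (oracleAdvice s k p) j) ((insideList s k j Z).map Served.pos)
        (A.run (insidePositions s k (oracleAdvice s k p) j)
          ((insideList s k j Z).map Served.pos)) := by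
  rw [logCost_eq_cost, hZ.map_server_insideList_divideLog,
    map_pos_insideList_congr (hZ.map_request_divideLog A)]
  exact (cost_map_getD (fun i hi => List.mem_range.1
    ((hZ.run_insidePositions_perm A hs hp j).mem_iff.1 hi)) _ _).symm

theorem map_server_insideList_divideLog_perm (hs : IsLine s k) (hp : Monotone p)
    (hZ : IsOptimalLog s k p r Z) (j : ℕ) :
    ((insideList s k j (divideLog A s k (oracleAdvice s k p) r)).map Served.server).Perm
      (insideServers s k (oracleAdvice s k p) j) := by
  rw [hZ.map_server_insideList_divideLog]
  refine ((hZ.run_insidePositions_perm A hs hp j).map _).trans (List.Perm.of_eq ?_)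
  exact List.ext_getElem (by simp) fun i _ hi => by simp [hi]

theorem server_notMem_marked (hs : IsLine s k) (hp : Monotone p) (hZ : IsOptimalLog s k p r Z)
    (he : e ∈ divideLog A s k (oracleAdvice s k p) r) (hinside : e.label = Label.inside) :
    e.server ∉ marked s k (oracleAdvice s k p) := by
  have hmem : e.server ∈ insideServers s k (oracleAdvice s k p) (blockOf s k e.pos) :=
    (hZ.map_server_insideList_divideLog_perm A hs hp _).mem_iff.1 (List.mem_map_of_mem
      (List.mem_filter.2 ⟨he, decide_eq_true ⟨hinside, rfl⟩⟩))
  exact (of_decide_eq_true (List.mem_filter.1 hmem).2 :).2.2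

theorem map_server_markedList_divideLog_perm_and_logCost (hs : IsLine s k) (hp : IsSorting s r p)
    (hZ : IsOptimalLog s k p r Z) :
    ((markedList (divideLog A s k (oracleAdvice s k p) r)).map Served.server).Perm
      ((markedList Z).map Served.server) ∧
    logCost s (markedList (divideLog A s k (oracleAdvice s k p) r)) =
      logCost s (markedList Z) := by
  have hsnd : ((markedList Z).map fun e => (e.directed, e.server)).map Prod.snd =
      (markedList Z).map Served.server := by simp [Function.comp_def]
  have hfst : ((markedList Z).map fun e => (e.directed, e.server)).map Prod.fst =
      (markedList (divideLog A s k (oracleAdvice s k p) r)).map Served.directed := by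
    rw [map_directed_markedList_congr (hZ.map_request_divideLog A)]
    simp [Function.comp_def]
  have hlr := lrRun_perm_and_cost hs.sorted (hZ.isDirected_markedList hs hp)
    (hsnd ▸ (hZ.perm.nodup_iff.2 List.nodup_range).sublist (List.filter_sublist.map _))
    (by
      rw [hsnd]
      intro j hj
      obtain ⟨e, he, rfl⟩ := List.mem_map.1 hj
      exact hZ.server_lt (List.mem_of_mem_filter he))
  rw [hsnd, hfst, hZ.toFinset_map_server_markedList hs hp.mono, ← map_server_markedList_divideLog
    fun e he => hZ.server_notMem_marked A hs hp.mono he] at hlr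
  refine ⟨hlr.1, ?_⟩
  simpa [logCost, List.zipWith_map, List.zipWith_self, Function.comp_def, Served.directed]
    using hlr.2

theorem isMatching_divideLog (hs : IsLine s k) (hp : IsSorting s r p)
    (hZ : IsOptimalLog s k p r Z) :
    IsMatching s.length ((divideLog A s k (oracleAdvice s k p) r).map Served.server) :=
  (map_server_perm_of_parts hs.pos (fun j =>
    (hZ.map_server_insideList_divideLog_perm A hs hp.mono j).trans
      (hZ.map_server_insideList_perm hs hp.mono j).symm)
    (hZ.map_server_markedList_divideLog_perm_and_logCost A hs hp).1).trans hZ.perm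

theorem logCost_divideLog (hs : IsLine s k) (hp : IsSorting s r p) (hZ : IsOptimalLog s k p r Z) :
    logCost s (divideLog A s k (oracleAdvice s k p) r) =
      ∑ j ∈ Finset.Icc 1 k,
        cost (insidePositions s k (oracleAdvice s k p) j) ((insideList s k j Z).map Served.pos)
          (A.run (insidePositions s k (oracleAdvice s k p) j)
            ((insideList s k j Z).map Served.pos)) +
      logCost s (markedList Z) := by
  rw [logCost_eq_sum hs.pos, (hZ.map_server_markedList_divideLog_perm_and_logCost A hs hp).2]
  simp only [hZ.logCost_insideList_divideLog A hs hp.mono]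

end Divide

end IsOptimalLog

/-! ### Inputs with integer requests -/

section IntegerRequests

variable {s r : List ℝ} {k : ℕ}

theorem trunc_intCast (s : List ℝ) (z : ℤ) :
    trunc s z = ((max 0 (min (span s : ℤ) z)).toNat : ℕ) := by
  rw [← Int.cast_natCast, Int.toNat_of_nonneg (le_max_left _ _), trunc]
  push_cast
  rfl

theorem exists_isSorting (hlength : r.length = s.length) (hinteger : ∀ x ∈ r, ∃ z : ℤ, x = z) :
    ∃ p, IsSorting s r p := by
  have htrunc : ∀ x ∈ r.map (trunc s), (⌊x⌋₊ : ℝ) = x ∧ x ≤ span s := by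
    intro x hx
    obtain ⟨y, hy, rfl⟩ := List.mem_map.1 hx
    obtain ⟨z, rfl⟩ := hinteger y hy
    rw [trunc_intCast, Nat.floor_natCast, Nat.cast_le]
    exact ⟨rfl, by omega⟩
  set l := ((r.map (trunc s)).map fun x => ⌊x⌋₊).insertionSort (· ≤ ·)
  have hperm : l.Perm ((r.map (trunc s)).map fun x => ⌊x⌋₊) := List.perm_insertionSort _ _
  have hsorted : l.Pairwise (· ≤ ·) := List.pairwise_insertionSort _ _
  have hl : l.length = s.length := by simp [hperm.length_eq, hlength]
  have hspan : ∀ y ∈ l, y ≤ span s := by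
    intro y hy
    obtain ⟨x, hx, rfl⟩ := List.mem_map.1 (hperm.mem_iff.1 hy)
    exact Nat.floor_le_of_le (htrunc x hx).2
  have hle (t : ℕ) : l.getD t (span s) ≤ span s := by
    rcases lt_or_ge t l.length with ht | ht
    · rw [List.getD_eq_getElem _ _ ht]
      exact hspan _ (List.getElem_mem ht)
    · rw [List.getD_eq_default _ _ ht]
  refine ⟨fun t => l.getD t (span s), fun i j hij => ?_, hle, ?_⟩
  · rcases lt_or_ge j l.length with hj | hj
    · rw [List.getD_eq_getElem _ _ (hij.trans_lt hj), List.getD_eq_getElem _ _ hj]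
      exact hsorted.rel_get_of_le (a := ⟨i, hij.trans_lt hj⟩) (b := ⟨j, hj⟩) hij
    · exact (hle i).trans_eq (List.getD_eq_default _ _ hj).symm
  · have hrange : ((List.range s.length).map fun t => l.getD t (span s)) = l :=
      List.ext_getElem (by simp [hl]) fun i _ hi => by simp [hi]
    have hfloor : ((r.map (trunc s)).map fun x => ⌊x⌋₊).map (Nat.cast : ℕ → ℝ) =
        r.map (trunc s) := by
      rw [List.map_map]
      exact (List.map_congr_left fun x hx => (htrunc x hx).1).trans (List.map_id _)
    have hcast := (hperm.map (Nat.cast : ℕ → ℝ)).symm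
    rw [hfloor, ← hrange, List.map_map] at hcast
    exact hcast

theorem span_eq {N : ℕ} (hN : 1 ≤ N) (hlast : s.getLast? = some ((N : ℝ) - 1)) : span s = N := by
  rw [span, List.getLastD_eq_getLast?, hlast, Option.getD_some, ← Nat.cast_pred hN,
    Nat.floor_natCast, Nat.sub_add_cancel hN]

theorem isLine_of_head_last {N : ℕ} (hs : s.Pairwise (· ≤ ·)) (hk : 0 < k) (hks : k ≤ s.length)
    (hhead : s.head? = some 1) (hlast : s.getLast? = some ((N : ℝ) - 1)) :
    IsLine s k ∧ span s = N ∧ 2 ≤ N := by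
  have hfirst : s.getD 0 0 = 1 := by
    rw [List.head?_eq_getElem?] at hhead
    simp [List.getD, hhead]
  have hend : s.getD (s.length - 1) 0 = N - 1 := by
    rw [List.getLast?_eq_getElem?] at hlast
    simp [List.getD, hlast]
  have hle := getD_le_getD hs (Nat.zero_le (s.length - 1)) (by omega)
  rw [hfirst, hend] at hle
  have hN : 2 ≤ N := by exact_mod_cast (by linarith : (2 : ℝ) ≤ N)
  have hspan := span_eq (by omega) hlast
  refine ⟨⟨hs, hk, hks, fun i hi => ?_, fun i hi => ?_⟩, hspan, hN⟩
  · exact hfirst.symm.trans_le (getD_le_getD hs (Nat.zero_le i) hi)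
  · rw [hspan, ← hend]
    exact getD_le_getD hs (by omega) (by omega)

end IntegerRequests

/-! ### Competitive algorithms -/

open MeasureTheory

theorem exists_abs_getD_le (s : List ℝ) : ∃ M, ∀ j, |s.getD j 0| ≤ M := by
  obtain ⟨M, hM⟩ := (s.toFinset.finite_toSet.insert 0).isBounded.exists_norm_le
  refine ⟨M, fun j => hM _ ?_⟩
  by_cases hj : j < s.length
  · simp [hj]
  · exact Set.mem_insert_iff.2 (Or.inl (List.getD_eq_default _ _ (not_lt.1 hj)))

theorem cost_append_singleton (s : List ℝ) {r : List ℝ} {σ : List ℕ}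
    (hlength : r.length = σ.length) (x : ℝ) (j : ℕ) :
    cost s (r ++ [x]) (σ ++ [j]) = cost s r σ + |x - s.getD j 0| := by
  rw [cost, List.zipWith_append hlength, List.sum_append, cost]
  simp

theorem opt_nil (r : List ℝ) : opt [] r = 0 :=
  le_antisymm ((opt_le_cost (s := []) (σ := []) (List.Perm.refl (List.range 0))).trans_eq
    (by simp [cost]))
    (opt_nonneg _ _)

theorem cost_replicate {m : ℕ} {σ : List ℕ} (hσ : IsMatching m σ) (x y : ℝ) :
    cost (List.replicate m x) (List.replicate m y) σ = m * |y - x| := by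
  have hlength : σ.length = m := by simpa using hσ.length_eq
  have hlt : ∀ j ∈ σ, j < m := fun j hj => List.mem_range.1 (hσ.mem_iff.1 hj)
  have hconst : List.zipWith (fun y j => |y - (List.replicate m x).getD j 0|)
      (List.replicate m y) σ = List.replicate m |y - x| :=
    List.ext_getElem (by simp [hlength]) fun i hi _ => by
      rw [List.length_zipWith, lt_min_iff] at hi
      simp [hlt _ (List.getElem_mem hi.2)]
  rw [cost, hconst, List.sum_replicate, nsmul_eq_mul]

theorem opt_replicate (m : ℕ) (x y : ℝ) :
    opt (List.replicate m x) (List.replicate m y) = m * |y - x| := by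
  have hcost {σ : List ℕ} (hσ : IsMatching (List.replicate m x).length σ) :=
    cost_replicate (List.length_replicate (a := x) (n := m) ▸ hσ) x y
  exact le_antisymm ((opt_le_cost (List.Perm.refl _)).trans_eq (hcost (List.Perm.refl _)))
    (le_opt fun σ hσ => (hcost hσ).ge)

section Competitive

variable {Ω : Type*} [MeasurableSpace Ω] {μ : Measure Ω} {A : Ω → OnlineAlg} {c : ℕ → ℝ} {α : ℝ}

theorem IsRandomized.integrable_cost_run [IsFiniteMeasure μ] (hA : IsRandomized A) {s r : List ℝ}
    (hlength : r.length ≤ s.length) : Integrable (fun ω => cost s r ((A ω).run s r)) μ := by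
  induction r using List.reverseRecOn with
  | nil => simp [cost]
  | append_singleton r x ih =>
    rw [List.length_append, List.length_singleton] at hlength
    obtain ⟨M, hM⟩ := exists_abs_getD_le s
    have hmeas : Measurable fun ω => |x - s.getD ((A ω).serve s r x) 0| :=
      (measurable_of_countable fun j : ℕ => |x - s.getD j 0|).comp (hA s r x (by omega))
    have hlast : Integrable (fun ω => |x - s.getD ((A ω).serve s r x) 0|) μ :=
      .of_bound hmeas.aestronglyMeasurable (|x| + M) <| .of_forall fun ω => by
        rw [Real.norm_eq_abs, abs_abs]
        exact (abs_sub _ _).trans (add_le_add_right (hM _) _)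
    refine ((ih (by omega)).add hlast).congr (.of_forall fun ω => ?_)
    simp only [Pi.add_apply, OnlineAlg.run, runServe_append]
    exact (cost_append_singleton s (by simp [runServe]) x _).symm

namespace IsCompetitive

theorem additive_nonneg (h : IsCompetitive μ A c α) : 0 ≤ α := by
  simpa [cost, opt_nil] using h [] [] ⟨List.Pairwise.nil, rfl⟩

theorem one_le [IsProbabilityMeasure μ] (h : IsCompetitive μ A c α) {m : ℕ} (hm : 1 ≤ m) :
    1 ≤ c m := by
  by_contra! hlt
  have hα := h.additive_nonneg
  set M : ℝ := (α + 1) / (1 - c m)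
  have hM : 0 ≤ M := div_nonneg (by linarith) (by linarith)
  have hinput : IsInput (List.replicate m (0 : ℝ)) (List.replicate m M) :=
    ⟨List.pairwise_replicate.2 (Or.inr le_rfl), by simp⟩
  have hcost (ω : Ω) := cost_replicate
    (List.length_replicate (a := (0 : ℝ)) (n := m) ▸ (A ω).legal _ _ hinput) 0 M
  have hle := h _ _ hinput
  simp only [OnlineAlg.run, hcost, opt_replicate, integral_const, List.length_replicate,
    probReal_univ, one_smul, sub_zero, abs_of_nonneg hM] at hle
  have hMmul : M * (1 - c m) = α + 1 := div_mul_cancel₀ _ (by linarith)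
  have hm' : (1 : ℝ) ≤ m := by exact_mod_cast hm
  nlinarith

theorem integral_cost_run_le [IsProbabilityMeasure μ] (h : IsCompetitive μ A c α)
    (hc : MonotoneOn c (Set.Ici 1)) {m : ℕ} {s r : List ℝ} (hinput : IsInput s r)
    (hm : s.length ≤ m) : ∫ ω, cost s r ((A ω).run s r) ∂μ ≤ c m * opt s r + α := by
  refine (h s r hinput).trans (add_le_add_left ?_ _)
  rcases s.length.eq_zero_or_pos with hzero | hpos
  · simp [List.eq_nil_of_length_eq_zero hzero, opt_nil]
  · exact mul_le_mul_of_nonneg_right (hc hpos (hpos.trans_le hm) hm) (opt_nonneg _ _)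

end IsCompetitive

/-! ### The cost of DIVIDE -/

variable {s r : List ℝ} {k : ℕ} {p : ℕ → ℕ} {Z : List Served}

theorem logCost_nonneg (s : List ℝ) (l : List Served) : 0 ≤ logCost s l := by
  rw [logCost_eq_cost]
  exact cost_nonneg _ _ _

theorem length_insideServers_le (hk : 0 < k) (a : DivideAdvice) {j : ℕ} (hj : 1 ≤ j) :
    (insideServers s k a j).length ≤ ⌈(s.length : ℝ) / k⌉₊ := by
  refine le_trans ?_ (blockEnd_sub_le hk hj)
  rw [← Nat.card_Ico, insideServers, ← List.toFinset_card_of_nodup (List.nodup_range.filter _)]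
  refine Finset.card_le_card fun i hi => ?_
  obtain ⟨hle, hlt, -⟩ := of_decide_eq_true (List.mem_filter.1 (List.mem_toFinset.1 hi)).2
  exact Finset.mem_Ico.2 ⟨hle, hlt⟩

namespace IsOptimalLog

theorem opt_insidePositions_le (hs : IsLine s k) (hp : Monotone p) (hZ : IsOptimalLog s k p r Z)
    (j : ℕ) : opt (insidePositions s k (oracleAdvice s k p) j)
      ((insideList s k j Z).map Served.pos) ≤ logCost s (insideList s k j Z) := by
  rw [logCost_eq_cost]
  exact opt_map_le (List.nodup_range.filter _) (hZ.map_server_insideList_perm hs hp j) _ _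

theorem integrable_logCost_divideLog [IsFiniteMeasure μ] (hA : IsRandomized A) (hs : IsLine s k)
    (hp : IsSorting s r p) (hZ : IsOptimalLog s k p r Z) :
    Integrable (fun ω => logCost s (divideLog (A ω) s k (oracleAdvice s k p) r)) μ := by
  simp only [fun ω => hZ.logCost_divideLog (A ω) hs hp]
  exact (integrable_finsetSum _ fun j _ => hA.integrable_cost_run
    (hZ.isInput_insidePositions hs hp.mono j).2.le).add (integrable_const _)

theorem integral_logCost_divideLog_le [IsProbabilityMeasure μ] (hA : IsRandomized A)
    (hcomp : IsCompetitive μ A c α) (hc : MonotoneOn c (Set.Ici 1)) (hs : IsLine s k)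
    (hp : IsSorting s r p) (hZ : IsOptimalLog s k p r Z) :
    ∫ ω, logCost s (divideLog (A ω) s k (oracleAdvice s k p) r) ∂μ ≤
      c ⌈(s.length : ℝ) / k⌉₊ * opt s r + k * α := by
  set C := c ⌈(s.length : ℝ) / k⌉₊
  have hC : 1 ≤ C := hcomp.one_le <| Nat.ceil_pos.2 <|
    div_pos (by exact_mod_cast hs.pos.trans_le hs.le_length) (by exact_mod_cast hs.pos)
  have hinput := hZ.isInput_insidePositions hs hp.mono
  have hintegrable := integrable_finsetSum (Finset.Icc 1 k) fun j _ =>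
    hA.integrable_cost_run (μ := μ) (hinput j).2.le
  have hblock : ∀ j ∈ Finset.Icc 1 k, ∫ ω, cost (insidePositions s k (oracleAdvice s k p) j)
      ((insideList s k j Z).map Served.pos) ((A ω).run
        (insidePositions s k (oracleAdvice s k p) j) ((insideList s k j Z).map Served.pos)) ∂μ ≤
      C * logCost s (insideList s k j Z) + α := fun j hj =>
    (hcomp.integral_cost_run_le hc (hinput j) (by
      rw [insidePositions, List.length_map]
      exact length_insideServers_le hs.pos _ (Finset.mem_Icc.1 hj).1)).trans
    (add_le_add_left (mul_le_mul_of_nonneg_left (hZ.opt_insidePositions_le hs hp.mono j)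
      (zero_le_one.trans hC)) _)
  have hmarked : logCost s (markedList Z) ≤ C * logCost s (markedList Z) :=
    le_mul_of_one_le_left (logCost_nonneg _ _) hC
  calc ∫ ω, logCost s (divideLog (A ω) s k (oracleAdvice s k p) r) ∂μ
      ≤ ∑ j ∈ Finset.Icc 1 k, (C * logCost s (insideList s k j Z) + α) +
          C * logCost s (markedList Z) := by
        simp only [fun ω => hZ.logCost_divideLog (A ω) hs hp]
        rw [integral_add hintegrable (integrable_const _), integral_finsetSum _ fun j _ =>
          hA.integrable_cost_run (hinput j).2.le, integral_const, probReal_univ, one_smul]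
        exact add_le_add (Finset.sum_le_sum hblock) hmarked
    _ = C * logCost s Z + k * α := by
        rw [logCost_eq_sum (l := Z) hs.pos, Finset.sum_add_distrib, ← Finset.mul_sum,
          Finset.sum_const, Nat.card_Icc, Nat.add_sub_cancel, nsmul_eq_mul]
        ring
    _ = C * opt s r + k * α := by rw [hZ.logCost_eq_opt hs hp]

end IsOptimalLog

theorem exists_tape_divide [IsProbabilityMeasure μ] (hA : IsRandomized A)
    (hc : MonotoneOn c (Set.Ici 1)) (hcomp : IsCompetitive μ A c α) (hs : IsLine s k)
    (hlength : r.length = s.length) (hinteger : ∀ x ∈ r, ∃ z : ℤ, x = z) :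
    ∃ tape : ℕ → Bool,
      (∀ ω, IsMatching s.length (((divide k (A ω)).run s r).eval tape)) ∧
      Integrable (fun ω => cost s r (((divide k (A ω)).run s r).eval tape)) μ ∧
      ∫ ω, cost s r (((divide k (A ω)).run s r).eval tape) ∂μ ≤
        c ⌈(s.length : ℝ) / k⌉₊ * opt s r + k * α := by
  obtain ⟨p, hp⟩ := exists_isSorting hlength hinteger
  obtain ⟨tape, htape⟩ := canOutput_readAdvice (isWritable_oracleAdvice hs hp.le_span)
  obtain ⟨Z, hZ⟩ := hp.exists_isOptimalLog hs
  have hcost (ω : Ω) : cost s r ((divideLog (A ω) s k (oracleAdvice s k p) r).map Served.server) =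
      logCost s (divideLog (A ω) s k (oracleAdvice s k p) r) := by
    rw [logCost_eq_cost, map_pos_eq_of_map_request_eq (hZ.map_request_divideLog (A ω)), hZ.map_pos]
  refine ⟨tape, ?_⟩
  simp only [eval_run_divide, htape, hcost]
  exact ⟨fun ω => hZ.isMatching_divideLog (A ω) hs hp, hZ.integrable_logCost_divideLog hA hs hp,
    hZ.integral_logCost_divideLog_le hA hcomp hc hs hp⟩

end Competitive

/-! ### The number of advice bits -/

theorem bits_divide_le (A : OnlineAlg) {s : List ℝ} {k : ℕ} (r : List ℝ) (hspan : 2 ≤ span s)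
    (hlength : 1 ≤ s.length) (tape : ℕ → Bool) :
    (((divide k A).run s r).bits tape : ℝ) ≤
      8 * (k * (Real.logb 2 (span s) + Real.logb 2 s.length)) := by
  have hbits : (((divide k A).run s r).bits tape : ℝ) ≤ ((k - 1 : ℕ) : ℝ) *
      (2 * ((Nat.log 2 (span s) : ℝ) + 1) + 4 * ((Nat.log 2 s.length : ℝ) + 1)) := by
    rw [bits_run_divide]
    exact_mod_cast bits_readAdvice_le s k tape
  have hk : ((k - 1 : ℕ) : ℝ) ≤ k := by exact_mod_cast Nat.sub_le k 1
  have hlogN : (Nat.log 2 (span s) : ℝ) ≤ Real.logb 2 (span s) := by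
    exact_mod_cast Real.natLog_le_logb (span s) 2
  have hlogn : (Nat.log 2 s.length : ℝ) ≤ Real.logb 2 s.length := by
    exact_mod_cast Real.natLog_le_logb s.length 2
  have hone : 1 ≤ Real.logb 2 (span s) := by
    rw [Real.le_logb_iff_rpow_le one_lt_two (by positivity), Real.rpow_one]
    exact_mod_cast hspan
  have hzero : 0 ≤ Real.logb 2 s.length :=
    Real.logb_nonneg one_lt_two (by exact_mod_cast hlength)
  calc (((divide k A).run s r).bits tape : ℝ)
      ≤ k * (2 * (Real.logb 2 (span s) + 1) + 4 * (Real.logb 2 s.length + 1)) := by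
        refine hbits.trans ?_
        gcongr
    _ ≤ k * (8 * (Real.logb 2 (span s) + Real.logb 2 s.length)) := by
        gcongr
        linarith only [hone, hzero]
    _ = 8 * (k * (Real.logb 2 (span s) + Real.logb 2 s.length)) := by ring

end LineMatching

end

open MeasureTheory LineMatching in
theorem mainTheorem3 :
    ∃ C : ℝ, ∀ (k : ℕ), 0 < k →
      ∀ (Ω : Type*) [MeasurableSpace Ω] (μ : Measure Ω) [IsProbabilityMeasure μ]
        (A : Ω → OnlineAlg), IsRandomized A →
      ∀ (c : ℕ → ℝ), MonotoneOn c (Set.Ici 1) →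
      ∀ (α : ℝ), IsCompetitive μ A c α →
      ∀ (n N : ℕ) (s r : List ℝ), IsInput s r → s.length = n → k ≤ n →
        s.head? = some 1 → s.getLast? = some ((N : ℝ) - 1) → (∀ x ∈ r, ∃ z : ℤ, x = z) →
        (∀ (ω : Ω) (tape : ℕ → Bool),
          (((divide k (A ω)).run s r).bits tape : ℝ) ≤
            C * (k * (Real.logb 2 N + Real.logb 2 n))) ∧
        ∃ tape : ℕ → Bool,
          (∀ ω, IsMatching n (((divide k (A ω)).run s r).eval tape)) ∧
          Integrable (fun ω => cost s r (((divide k (A ω)).run s r).eval tape)) μ ∧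
          ∫ ω, cost s r (((divide k (A ω)).run s r).eval tape) ∂μ ≤
            c ⌈(n : ℝ) / k⌉₊ * opt s r + k * α := by
  refine ⟨8, ?_⟩
  rintro k hk Ω _ μ _ A hA c hc α hcomp n N s r ⟨hsorted, hlength⟩ rfl hkn hhead hlast hinteger
  obtain ⟨hs, rfl, hN⟩ := isLine_of_head_last hsorted hk hkn hhead hlast
  exact ⟨fun ω => bits_divide_le (A ω) r hN (hk.trans_le hkn),
    exists_tape_divide hA hc hcomp hs hlength hinteger⟩
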